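/- **Model.** Fix an integer $m\ge 1$ and a real $\delta>-m$, and put $\tau=3+\delta/m$. The sequential preferential attachment graph $\mathrm{PA}_t=\mathrm{PA}_t(m,\delta)$ is the random multigraph on the vertices $1,\dots,t$ constructed as follows. $\mathrm{PA}_1$ is a single vertex without edges, and $\mathrm{PA}_2$ has $m$ edges, labeled $1,\dots,m$, from vertex $2$ to vertex $1$. For $t\ge 3$, given $\mathrm{PA}_{t-1}$, a new vertex $t$ is added with $m$ edges labeled $1,\dots,m$ that start from $t$ and are attached one after the other: given the graph obtained after the first $j-1$ of them have been attached, the $j$-th one ends at vertex $i\in\{1,\dots,t-1\}$ with probability $$\frac{D_i(t-1,j-1)+\delta}{2m(t-2)+(j-1)+(t-1)\delta},$$ where $D_i(t-1,j-1)$ is the degree of $i$ (incoming plus outgoing edges, with multiplicity) in that graph. **Subgraphs.** Let $H$ be a finite directed graph on $k$ vertices and let $\pi$ be a bijection from its vertices to $\{1,\dots,k\}$ (the order of arrival, so that $\pi(a)<\pi(b)$ means that $a$ is older than $b$). The pair $(H,\pi)$ is attainable if every edge $a\to b$ of $H$ goes from a newer to an older vertex, i.e. $\pi(b)<\pi(a)$,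 and every out-degree in $H$ is at most $m$. Let $N_t(H,\pi)$ be the number of labeled copies of $(H,\pi)$ in $\mathrm{PA}_t$: a copy consists of an injective map $\varphi$ from the vertices of $H$ to $\{1,\dots,t\}$ that respects the order ($\varphi(a)<\varphi(b)$ if and only if $\pi(a)<\pi(b)$) together with, for each edge $a\to b$ of $H$, one labeled edge of $\mathrm{PA}_t$ from $\varphi(a)$ to $\varphi(b)$. With $d^{\mathrm{in}}_H$ and $d^{\mathrm{out}}_H$ the in- and out-degrees in $H$, put $$\beta(v)=\frac{\tau-2}{\tau-1}\bigl(d^{\mathrm{in}}_H(v)-d^{\mathrm{out}}_H(v)\bigr)-d^{\mathrm{in}}_H(v),\qquad B(H,\pi)=\max_{s=0,1,\dots,k}\Bigl(-s+\sum_{i=s+1}^{k}\beta(\pi^{-1}(i))\Bigr).$$ **Theorem.** Let $(H,\pi)$ be attainable, and let $r$ be the number of $s\in\{0,1,\dots,k\}$ at which the maximum $B(H,\pi)$ is attained. Then there exist $0<C_1\le C_2<\infty$ such that the following limit exists and $$C_1\le\lim_{t\to\infty}\frac{\mathbb{E}[N_t(H,\pi)]}{t^{\,k+B(H,\pi)}\,\log^{r-1}(t)}\le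 C_2 .$$ -/

import Mathlib

open Filter Topology MeasureTheory

namespace PrefAttach

/-! ### The sequential preferential attachment model

Vertices are numbered from `0`, in order of arrival, so the vertex `i` below is the `(i+1)`-st vertex
to arrive. Edge labels are numbered from `0` too. -/

/-- The possible realizations of the labeled multigraph on the `t` vertices `0, …, t-1`: the vertex `0`
has no outgoing edge, and each vertex `v + 1` has `m` labeled outgoing edges; the one with label `j`
ends at the vertex `G (v, j)`, which is one of the older vertices `0, …, v`. -/
abbrev Graph (m t : ℕ) : Type := (e : Fin (t - 1) × Fin m) → Fin (e.1 + 1)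

/-- The edges of the graph are attached one at a time: `f` is attached before `e`. -/
def Before {m t : ℕ} (f e : Fin (t - 1) × Fin m) : Prop :=
  f.1 < e.1 ∨ (f.1 = e.1 ∧ f.2 < e.2)

open Classical in
/-- The degree (outgoing plus incoming edges) of the vertex `i` in the graph formed by the edges that
are attached before `e`. -/
noncomputable def degBefore {m t : ℕ} (G : Graph m t) (e : Fin (t - 1) × Fin m) (i : ℕ) : ℕ :=
  (Finset.univ.filter fun f : Fin (t - 1) × Fin m => Before f e ∧ (f.1 : ℕ) + 1 = i).card +
  (Finset.univ.filter fun f : Fin (t - 1) × Fin m => Before f e ∧ (G f : ℕ) = i).card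

/-- The conditional probability that the edge `e = (v, j)`, which is the `(j+1)`-st edge of the
`(v+2)`-nd vertex, is attached to the vertex `i`, given the edges attached before it. All edges of the
second vertex end at the first one (the only possible value of `i` if `v = 0`). -/
noncomputable def attachProb {m t : ℕ} (δ : ℝ) (G : Graph m t) (e : Fin (t - 1) × Fin m)
    (i : ℕ) : ℝ :=
  if (e.1 : ℕ) = 0 then 1
  else (degBefore G e i + δ) / (2 * m * (e.1 : ℕ) + (e.2 : ℕ) + ((e.1 : ℕ) + 1) * δ)

/-- The probability of the realization `G`, by the chain rule. -/
noncomputable def weight {m t : ℕ} (δ : ℝ) (G : Graph m t) : ℝ :=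
  ∏ e, attachProb δ G e (G e)

/-- If each factor of a product of conditional probabilities sums to `1`, so does the product. -/
theorem sum_prod_chain {ι : Type*} [Fintype ι] [DecidableEq ι] {α : ι → Type*}
    [∀ i, Fintype (α i)] [∀ i, DecidableEq (α i)] (r : ι → ℕ)
    (p : ι → (∀ i, α i) → ℝ)
    (hloc : ∀ i j (ω : ∀ i, α i) (x : α j), i ≠ j → r i ≤ r j →
      p i (Function.update ω j x) = p i ω)
    (hsum : ∀ i ω, ∑ a, p i (Function.update ω i a) = 1) (ω₀ : ∀ i, α i) :
    ∑ ω, ∏ i, p i ω = 1 := by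
  have key : ∀ S : Finset ι,
      ∑ ω ∈ Fintype.piFinset (fun i => if i ∈ S then Finset.univ else {ω₀ i}),
        ∏ i ∈ S, p i ω = 1 := by
    intro S
    induction S using Finset.induction_on_max_value r with
    | empty => simp
    | insert a S ha hmax ih =>
      rw [← ih]
      have h1 : ∑ ω ∈ Fintype.piFinset (fun i => if i ∈ insert a S then Finset.univ else {ω₀ i}),
          ∏ i ∈ insert a S, p i ω =
          ∑ q ∈ (Fintype.piFinset (fun i => if i ∈ S then Finset.univ else {ω₀ i})) ×ˢ
            (Finset.univ : Finset (α a)),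
          p a (Function.update q.1 a q.2) * ∏ i ∈ S, p i q.1 := by
        refine Finset.sum_bij' (fun ω _ => (Function.update ω a (ω₀ a), ω a))
          (fun q _ => Function.update q.1 a q.2) ?_ ?_ ?_ ?_ ?_
        · intro ω hω
          simp only [Finset.mem_product, Fintype.mem_piFinset, Finset.mem_univ, and_true] at hω ⊢
          intro i
          by_cases hi : i = a
          · subst hi
            simp [ha]
          · have := hω i
            simpa [hi] using this
        · intro q hq
          simp only [Finset.mem_product, Fintype.mem_piFinset, Finset.mem_univ, and_true] at hq ⊢
          intro i
          by_cases hi : i = a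
          · subst hi
            simp
          · have := hq i
            simpa [hi] using this
        · intro ω hω
          simp
        · rintro ⟨ω, x⟩ hq
          simp only [Finset.mem_product, Fintype.mem_piFinset, Finset.mem_univ, and_true] at hq
          have := hq a
          simp only [ha, if_false, Finset.mem_singleton] at this
          simp [← this]
        · intro ω hω
          rw [Finset.prod_insert ha]
          simp only [Function.update_idem, Function.update_eq_self]
          congr 1
          refine Finset.prod_congr rfl fun i hi => ?_
          rw [hloc i a ω _ (fun h => ha (h ▸ hi)) (hmax i hi)]
      rw [h1, Finset.sum_product]
      refine Finset.sum_congr rfl fun ω _ => ?_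
      simp only
      rw [← Finset.sum_mul, hsum, one_mul]
  have := key Finset.univ
  simpa using this

theorem before_irrefl {m t : ℕ} (e : Fin (t - 1) × Fin m) : ¬ Before e e := by
  simp [Before]

theorem degBefore_update {m t : ℕ} (G : Graph m t) (e g : Fin (t - 1) × Fin m)
    (h : ¬ Before g e) (x : Fin (g.1 + 1)) (i : ℕ) :
    degBefore (Function.update G g x) e i = degBefore G e i := by
  unfold degBefore
  congr 2
  ext f
  simp only [Finset.mem_filter, Finset.mem_univ, true_and]
  refine and_congr_right fun hf => ?_
  have : f ≠ g := fun hfg => h (hfg ▸ hf)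
  rw [Function.update_of_ne this]

theorem le_degBefore {m t : ℕ} (G : Graph m t) (e : Fin (t - 1) × Fin m)
    (he : (e.1 : ℕ) ≠ 0) (i : ℕ) (hi : i ≤ e.1) : m ≤ degBefore G e i := by
  classical
  unfold degBefore
  rcases Nat.eq_zero_or_pos i with h0 | h0
  · refine le_trans ?_ (Nat.le_add_left _ _)
    have h2 : 0 < t - 1 := lt_of_le_of_lt (Nat.zero_le _) e.1.2
    calc m = ((Finset.univ : Finset (Fin m)).image
          fun j => ((⟨0, h2⟩ : Fin (t - 1)), j)).card := by
            rw [Finset.card_image_of_injective _ (fun a b h => by simpa using h)]; simp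
      _ ≤ _ := by
        refine Finset.card_le_card fun f hf => ?_
        simp only [Finset.mem_image, Finset.mem_univ, true_and] at hf
        obtain ⟨j, rfl⟩ := hf
        simp only [Finset.mem_filter, Finset.mem_univ, true_and]
        refine ⟨Or.inl (Fin.lt_def.2 (Nat.pos_of_ne_zero he)), ?_⟩
        have := (G (⟨0, h2⟩, j)).2
        simp only at this
        omega
  · refine le_trans ?_ (Nat.le_add_right _ _)
    have h2 : i - 1 < t - 1 := lt_of_lt_of_le (by omega) (le_of_lt e.1.2)
    calc m = ((Finset.univ : Finset (Fin m)).image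
          fun j => ((⟨i - 1, h2⟩ : Fin (t - 1)), j)).card := by
            rw [Finset.card_image_of_injective _ (fun a b h => by simpa using h)]; simp
      _ ≤ _ := by
        refine Finset.card_le_card fun f hf => ?_
        simp only [Finset.mem_image, Finset.mem_univ, true_and] at hf
        obtain ⟨j, rfl⟩ := hf
        simp only [Finset.mem_filter, Finset.mem_univ, true_and]
        refine ⟨Or.inl (Fin.lt_def.2 ?_), ?_⟩
        · simp only
          omega
        · omega

theorem card_before {m t : ℕ} (e : Fin (t - 1) × Fin m) [DecidablePred fun f => Before f e] :
    (Finset.univ.filter fun f => Before f e).card = m * (e.1 : ℕ) + (e.2 : ℕ) := by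
  classical
  have : (Finset.univ.filter fun f => Before f e) =
      (Finset.Iio e.1 ×ˢ (Finset.univ : Finset (Fin m))) ∪ ({e.1} ×ˢ Finset.Iio e.2) := by
    ext f
    simp only [Finset.mem_filter, Finset.mem_univ, true_and, Finset.mem_union,
      Finset.mem_product, Finset.mem_Iio, and_true, Finset.mem_singleton]
    rfl
  rw [this, Finset.card_union_of_disjoint]
  · simp [mul_comm]
  · rw [Finset.disjoint_left]
    rintro f h1 h2
    simp only [Finset.mem_product, Finset.mem_Iio, Finset.mem_singleton] at h1 h2
    exact absurd h1.1 (by simp [h2.1])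

theorem sum_degBefore {m t : ℕ} (G : Graph m t) (e : Fin (t - 1) × Fin m) :
    ∑ x : Fin (e.1 + 1), degBefore G e x = 2 * m * (e.1 : ℕ) + (e.2 : ℕ) := by
  classical
  unfold degBefore
  rw [Finset.sum_add_distrib]
  have hA : ∑ x : Fin (e.1 + 1), (Finset.univ.filter fun f : Fin (t - 1) × Fin m =>
      Before f e ∧ (f.1 : ℕ) + 1 = x).card = m * (e.1 : ℕ) := by
    rw [← Finset.card_biUnion]
    · have : ((Finset.univ : Finset (Fin (e.1 + 1))).biUnion fun x =>
          Finset.univ.filter fun f : Fin (t - 1) × Fin m => Before f e ∧ (f.1 : ℕ) + 1 = x) =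
          (Finset.Iio e.1 ×ˢ (Finset.univ : Finset (Fin m))) := by
        ext f
        simp only [Finset.mem_biUnion, Finset.mem_univ, true_and, Finset.mem_filter,
          Finset.mem_product, Finset.mem_Iio, and_true]
        constructor
        · rintro ⟨x, -, hx⟩
          have := x.2
          exact Fin.lt_def.2 (by omega)
        · intro h
          have h' := Fin.lt_def.1 h
          exact ⟨⟨(f.1 : ℕ) + 1, by omega⟩, Or.inl h, rfl⟩
      rw [this]
      simp [mul_comm]
    · intro x _ y _ hxy
      rw [Function.onFun, Finset.disjoint_left]
      intro f h1 h2
      simp only [Finset.mem_filter, Finset.mem_univ, true_and] at h1 h2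
      exact hxy (Fin.ext (h1.2.symm.trans h2.2))
  have hB : ∑ x : Fin (e.1 + 1), (Finset.univ.filter fun f : Fin (t - 1) × Fin m =>
      Before f e ∧ (G f : ℕ) = x).card = m * (e.1 : ℕ) + (e.2 : ℕ) := by
    rw [← Finset.card_biUnion]
    · rw [← card_before e]
      congr 1
      ext f
      simp only [Finset.mem_biUnion, Finset.mem_univ, true_and, Finset.mem_filter]
      constructor
      · rintro ⟨x, h, -⟩
        exact h
      · intro h
        have h2 := (G f).2
        have h3 : (f.1 : ℕ) ≤ e.1 := by
          rcases h with h | h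
          · exact le_of_lt (Fin.lt_def.1 h)
          · rw [h.1]
        exact ⟨⟨(G f : ℕ), by omega⟩, h, rfl⟩
    · intro x _ y _ hxy
      rw [Function.onFun, Finset.disjoint_left]
      intro f h1 h2
      simp only [Finset.mem_filter, Finset.mem_univ, true_and] at h1 h2
      exact hxy (Fin.ext (h1.2.symm.trans h2.2))
  rw [hA, hB]
  ring

theorem denom_pos {m t : ℕ} {δ : ℝ} (hδ : -(m : ℝ) < δ) (e : Fin (t - 1) × Fin m)
    (he : (e.1 : ℕ) ≠ 0) :
    0 < 2 * (m : ℝ) * (e.1 : ℕ) + (e.2 : ℕ) + (((e.1 : ℕ) : ℝ) + 1) * δ := by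
  have h1 : (1 : ℝ) ≤ ((e.1 : ℕ) : ℝ) := by exact_mod_cast Nat.one_le_iff_ne_zero.2 he
  have h2 : (0 : ℝ) ≤ ((e.2 : ℕ) : ℝ) := Nat.cast_nonneg _
  have h3 : (0 : ℝ) ≤ (m : ℝ) := Nat.cast_nonneg _
  nlinarith [mul_pos (by linarith : (0 : ℝ) < ((e.1 : ℕ) : ℝ) + 1) (by linarith : 0 < δ + m),
    mul_nonneg h3 (by linarith : (0 : ℝ) ≤ ((e.1 : ℕ) : ℝ) - 1)]

theorem weight_nonneg {m t : ℕ} {δ : ℝ} (hδ : -(m : ℝ) < δ) (G : Graph m t) :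
    0 ≤ weight δ G := by
  refine Finset.prod_nonneg fun e _ => ?_
  unfold attachProb
  split_ifs with he
  · exact zero_le_one
  · refine div_nonneg ?_ (denom_pos hδ e he).le
    have : (m : ℝ) ≤ degBefore G e (G e) := by
      exact_mod_cast le_degBefore G e he _ (Nat.lt_succ_iff.1 (G e).2)
    linarith

theorem sum_weight {m t : ℕ} {δ : ℝ} (hδ : -(m : ℝ) < δ) :
    ∑ G : Graph m t, weight δ G = 1 := by
  refine sum_prod_chain (fun e : Fin (t - 1) × Fin m => (e.1 : ℕ) * m + (e.2 : ℕ))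
    (fun e G => attachProb δ G e (G e)) ?_ ?_ (fun _ => 0)
  · intro e g G x hne hle
    have hb : ¬ Before g e := by
      rintro (h | ⟨h1, h2⟩)
      · have h' := Fin.lt_def.1 h
        have h3 := g.2.2
        have : ((g.1 : ℕ) + 1) * m ≤ (e.1 : ℕ) * m := Nat.mul_le_mul_right _ h'
        have h4 : (e.1 : ℕ) * m + (e.2 : ℕ) ≤ (g.1 : ℕ) * m + (g.2 : ℕ) := hle
        rw [Nat.add_mul] at this
        omega
      · have h' := Fin.lt_def.1 h2
        have h4 : (e.1 : ℕ) * m + (e.2 : ℕ) ≤ (g.1 : ℕ) * m + (g.2 : ℕ) := hle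
        rw [h1] at h4
        omega
    simp only [attachProb, degBefore_update G e g hb, Function.update_of_ne hne]
  · intro e G
    simp only [attachProb, degBefore_update G e e (before_irrefl e), Function.update_self]
    by_cases he : (e.1 : ℕ) = 0
    · simp [he]
    · simp only [he, if_false]
      rw [← Finset.sum_div, Finset.sum_add_distrib]
      have h := sum_degBefore G e
      have h' : ∑ x : Fin (e.1 + 1), (degBefore G e x : ℝ) =
          2 * m * (e.1 : ℕ) + (e.2 : ℕ) := by exact_mod_cast h
      rw [h']
      simp only [Finset.sum_const, Finset.card_univ, Fintype.card_fin, nsmul_eq_mul]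
      push_cast
      exact div_self (denom_pos hδ e he).ne'

/-- The law of the sequential preferential attachment graph with `t` vertices. -/
noncomputable def PA (m : ℕ) (δ : ℝ) (hδ : -(m : ℝ) < δ) (t : ℕ) : PMF (Graph m t) :=
  PMF.ofFintype (fun G => ENNReal.ofReal (weight δ G)) (by
    rw [← ENNReal.ofReal_sum_of_nonneg (fun G _ => weight_nonneg hδ G), sum_weight hδ,
      ENNReal.ofReal_one])

/-- In `G`, the edge with label `j` of the vertex `v` ends at the vertex `u`. -/
def IsEdge {m t : ℕ} (G : Graph m t) (j : Fin m) (v u : Fin t) : Prop :=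
  ∃ w : Fin (t - 1), (w : ℕ) + 1 = v ∧ (G (w, j) : ℕ) = u

/-! ### Ordered subgraphs

`H.Adj a b` means that `H` has the edge from `a` to `b`; the ordering is a bijection `π` of the vertices
of `H` with `{0, …, k-1}`. -/

section Subgraph

variable {V : Type*} [Fintype V]

open Classical in
/-- The in-degree in `H`. -/
noncomputable def inDeg (H : Digraph V) (v : V) : ℕ :=
  (Finset.univ.filter fun u => H.Adj u v).card

open Classical in
/-- The out-degree in `H`. -/
noncomputable def outDeg (H : Digraph V) (v : V) : ℕ :=
  (Finset.univ.filter fun u => H.Adj v u).card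

/-- All edges of `H` go from a newer to an older vertex (so that `H` is a directed acyclic graph and
its adjacency matrix, ordered by `π`, is strictly triangular), and all out-degrees are at most `m`. -/
def Attainable (m : ℕ) (H : Digraph V) {k : ℕ} (π : V ≃ Fin k) : Prop :=
  (∀ a b, H.Adj a b → π b < π a) ∧ ∀ a, outDeg H a ≤ m

open Classical in
/-- The number of labeled copies of `(H, π)` in `G`. A copy consists of vertices of `G`, one for each
vertex of `H` and in the prescribed order of arrival, and of one labeled edge of `G` for each edge of
`H`. (The order determines the vertices from their set, and an edge of `G` determines the edge of `H`
that it stands for, so distinct pairs `(φ, ℓ)` give distinct labeled subgraphs.) -/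
noncomputable def copies {m t : ℕ} (H : Digraph V) {k : ℕ} (π : V ≃ Fin k) (G : Graph m t) : ℕ :=
  (Finset.univ.filter fun c : (V → Fin t) × ({e : V × V // H.Adj e.1 e.2} → Fin m) =>
    (∀ a b, c.1 a < c.1 b ↔ π a < π b) ∧
    ∀ e, IsEdge G (c.2 e) (c.1 e.1.1) (c.1 e.1.2)).card

/-- The expected number of copies of `(H, π)` in the preferential attachment graph. -/
noncomputable def expectedCopies (m : ℕ) (δ : ℝ) (hδ : -(m : ℝ) < δ) (H : Digraph V) {k : ℕ}
    (π : V ≃ Fin k) (t : ℕ) : ℝ :=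
  ∫ G, (copies H π G : ℝ) ∂(PA m δ hδ t).toMeasure

/-- The power-law exponent of the degrees. -/
noncomputable def tau (m : ℕ) (δ : ℝ) : ℝ := 3 + δ / m

/-- The exponent attached to a vertex of `H`. -/
noncomputable def beta (m : ℕ) (δ : ℝ) (H : Digraph V) (v : V) : ℝ :=
  (tau m δ - 2) / (tau m δ - 1) * ((inDeg H v : ℝ) - outDeg H v) - inDeg H v

/-- The objective function of the optimization problem: `-s` plus the exponents of all but the `s`
oldest vertices. -/
noncomputable def objective (m : ℕ) (δ : ℝ) (H : Digraph V) {k : ℕ} (π : V ≃ Fin k) (s : ℕ) : ℝ :=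
  -(s : ℝ) + ∑ i ∈ Finset.univ.filter (fun i : Fin k => s ≤ (i : ℕ)), beta m δ H (π.symm i)

/-- The optimal value, over `s ∈ {0, …, k}`. -/
noncomputable def optValue (m : ℕ) (δ : ℝ) (H : Digraph V) {k : ℕ} (π : V ≃ Fin k) : ℝ :=
  (Finset.range (k + 1)).sup' Finset.nonempty_range_add_one (objective m δ H π)

open Classical in
/-- The number of optimizers `s ∈ {0, …, k}`; it is at least `1`. -/
noncomputable def numOptimizers (m : ℕ) (δ : ℝ) (H : Digraph V) {k : ℕ} (π : V ≃ Fin k) : ℕ :=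
  ((Finset.range (k + 1)).filter fun s => objective m δ H π s = optValue m δ H π).card

end Subgraph

end PrefAttach

/-!
The graph is a Pólya urn in disguise. Give each vertex `v ≥ 1` an independent Beta variable `ψ v`, and
`ψ 0 = 1`; given these, the edges are independent, and an edge of a vertex newer than `v` that ends
at `v` or before takes `v` with probability `ψ v`. Hence the probability that given edges are
present is a product over the vertices `v` of mixed moments `E[ψ v ^ p * (1 - ψ v) ^ q]`, where `p` of
the edges end at `v` and `q` pass over it. No random variables are needed to prove this: `urnMoment`
is the explicit moment, stick breaking shows that the product formula `edgeProb` is consistent under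
forgetting an edge (`edgeProb_eq_sum`), and for the edges in the order of attachment it is the
preferential attachment rule (`stickProb_edgesBefore`). So `edgeProb` is the joint law of any set of
edges (`sum_weight_filter`).

In a copy with vertices `p 0 < p 1 < ⋯`, the same edges pass over all vertices strictly between two
consecutive `p i`. The product over such a gap is a quotient of values of `passProb`, and therefore
the probability of the copy factorizes as `∏ i, entryWeight i (p i)` (`prod_urnMoment_eq`). By Euler's
limit formula for the Gamma function, `passProb c n` is asymptotic to a multiple of `n ^ (-χ * c)` with
`χ = (m + δ) / (2 * m + δ) = (τ - 2) / (τ - 1)`, so that `entryWeight i n` is asymptotic to a positive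
multiple of `n ^ β i` (`hasPowerLaw_vertexWeight`, `beta_eq`).

It remains to sum such a product over all increasing tuples below `t`, one entry after the other. If
the sum over the first `k` entries is of the order `t ^ E * log t ^ l`, the next summation gives the
order `t ^ (E + β k + 1) * log t ^ l`, or `log t ^ (l + 1)`, or a convergent series, according to whether
`E + β k + 1` is positive, zero or negative (`tendsto_simplexSum`). This is the recursion for
`k + B` and for the number of optimizers.
-/

namespace PrefAttach

/-! ### The Pólya urn representation -/

/-- The mixed moment `E[ψ ^ p * (1 - ψ) ^ q]` of the Beta variable `ψ` with parameters `m + δ` and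
`m * (2 * v - 1) + v * δ`, written with rising factorials. The variable of the vertex `0` is the
constant `1`; no edge passes over this vertex, so only `q = 0` matters, and the value `1` is used for
every `q`. -/
noncomputable def urnMoment (m : ℕ) (δ : ℝ) (v p q : ℕ) : ℝ :=
  if v = 0 then 1 else
    (∏ j ∈ Finset.range p, ((m : ℝ) + δ + j)) *
      (∏ j ∈ Finset.range q, ((m : ℝ) * (2 * v - 1) + v * δ + j)) /
      ∏ j ∈ Finset.range (p + q), (2 * (m : ℝ) * v + (v + 1) * δ + j)

/-- The mean of the Beta variable of the vertex `v` after `p` successes and `q` failures. -/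
noncomputable def urnHit (m : ℕ) (δ : ℝ) (v p q : ℕ) : ℝ :=
  if v = 0 then 1 else ((m : ℝ) + δ + p) / (2 * (m : ℝ) * v + (v + 1) * δ + (p + q : ℕ))

/-- The complement of `urnHit`. -/
noncomputable def urnMiss (m : ℕ) (δ : ℝ) (v p q : ℕ) : ℝ :=
  if v = 0 then 0 else
    ((m : ℝ) * (2 * v - 1) + v * δ + q) / (2 * (m : ℝ) * v + (v + 1) * δ + (p + q : ℕ))

theorem total_pos {m : ℕ} {δ : ℝ} (hδ : -(m : ℝ) < δ) {v : ℕ} (hv : v ≠ 0) (j : ℕ) :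
    0 < 2 * (m : ℝ) * v + (v + 1) * δ + j := by
  have h1 : (1 : ℝ) ≤ v := by exact_mod_cast Nat.one_le_iff_ne_zero.2 hv
  have h2 : (0 : ℝ) ≤ j := Nat.cast_nonneg _
  have h3 : (0 : ℝ) ≤ (m : ℝ) := Nat.cast_nonneg _
  nlinarith [mul_pos (by linarith : (0 : ℝ) < (v : ℝ) + 1) (by linarith : 0 < δ + m),
    mul_nonneg h3 (by linarith : (0 : ℝ) ≤ (v : ℝ) - 1)]

theorem older_pos {m : ℕ} {δ : ℝ} (hδ : -(m : ℝ) < δ) {v : ℕ} (hv : v ≠ 0) (j : ℕ) :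
    0 < (m : ℝ) * (2 * v - 1) + v * δ + j := by
  have h1 : (1 : ℝ) ≤ v := by exact_mod_cast Nat.one_le_iff_ne_zero.2 hv
  have h2 : (0 : ℝ) ≤ j := Nat.cast_nonneg _
  have h3 : (0 : ℝ) ≤ (m : ℝ) := Nat.cast_nonneg _
  nlinarith [mul_pos (by linarith : (0 : ℝ) < (v : ℝ)) (by linarith : 0 < δ + m),
    mul_nonneg h3 (by linarith : (0 : ℝ) ≤ (v : ℝ) - 1)]

theorem urnMoment_pos {m : ℕ} {δ : ℝ} (hδ : -(m : ℝ) < δ) (v p q : ℕ) :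
    0 < urnMoment m δ v p q := by
  unfold urnMoment
  split_ifs with h
  · exact one_pos
  · have h1 : ∀ j : ℕ, 0 < (m : ℝ) + δ + j := fun j => by
      have := Nat.cast_nonneg (α := ℝ) j
      linarith
    exact div_pos (mul_pos (Finset.prod_pos fun j _ => h1 j)
      (Finset.prod_pos fun j _ => older_pos hδ h j)) (Finset.prod_pos fun j _ => total_pos hδ h j)

theorem urnMoment_zero_zero (m : ℕ) (δ : ℝ) (v : ℕ) : urnMoment m δ v 0 0 = 1 := by
  simp [urnMoment]

theorem urnMoment_succ_left (m : ℕ) (δ : ℝ) (v p q : ℕ) :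
    urnMoment m δ v (p + 1) q = urnMoment m δ v p q * urnHit m δ v p q := by
  unfold urnMoment urnHit
  split_ifs with h
  · simp
  · rw [Finset.prod_range_succ, show p + 1 + q = p + q + 1 by ring,
      Finset.prod_range_succ _ (p + q), div_mul_div_comm]
    congr 1
    ring

theorem urnMoment_succ_right (m : ℕ) (δ : ℝ) {v : ℕ} (hv : v ≠ 0) (p q : ℕ) :
    urnMoment m δ v p (q + 1) = urnMoment m δ v p q * urnMiss m δ v p q := by
  unfold urnMoment urnMiss
  rw [if_neg hv, if_neg hv, if_neg hv, Finset.prod_range_succ, ← add_assoc p q 1,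
    Finset.prod_range_succ _ (p + q), div_mul_div_comm]
  congr 1
  ring

theorem urnHit_add_urnMiss {m : ℕ} {δ : ℝ} (hδ : -(m : ℝ) < δ) (v p q : ℕ) :
    urnHit m δ v p q + urnMiss m δ v p q = 1 := by
  unfold urnHit urnMiss
  split_ifs with h
  · simp
  · have := (total_pos hδ h (p + q)).ne'
    rw [← add_div, div_eq_one_iff_eq this]
    push_cast
    ring

/-- Stick breaking: if the last stick is taken whole, the pieces sum to the whole. -/
theorem sum_stick {x y : ℕ → ℝ} (h0 : x 0 = 1) (h : ∀ v, x v + y v = 1) (n : ℕ) :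
    ∑ u : Fin (n + 1), x u * ∏ w ∈ Finset.Ioc (u : ℕ) n, y w = 1 := by
  rw [Fin.sum_univ_eq_sum_range fun u => x u * ∏ w ∈ Finset.Ioc u n, y w]
  induction n with
  | zero => simp [h0]
  | succ n ih =>
    rw [Finset.sum_range_succ]
    have : ∀ u ∈ Finset.range (n + 1), x u * ∏ w ∈ Finset.Ioc u (n + 1), y w =
        (x u * ∏ w ∈ Finset.Ioc u n, y w) * y (n + 1) := by
      intro u hu
      rw [Finset.prod_Ioc_succ_top (Nat.lt_succ_iff.1 (Finset.mem_range.1 hu)), mul_assoc]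
    rw [Finset.sum_congr rfl this, ← Finset.sum_mul, ih]
    simp [add_comm, h]

theorem prod_telescope {T : ℕ → ℝ} {u n : ℕ} (hun : u ≤ n) (hT : ∀ v, u ≤ v → v ≤ n → T v ≠ 0) :
    ∏ w ∈ Finset.Ioc u n, T (w - 1) / T w = T u / T n := by
  induction n, hun using Nat.le_induction with
  | base => simp [div_self (hT u le_rfl le_rfl)]
  | succ n hn ih =>
    rw [Finset.prod_Ioc_succ_top (by omega), ih fun v h1 h2 => hT v h1 (by omega),
      Nat.add_sub_cancel, div_mul_div_cancel₀ (hT n hn (by omega))]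

section

variable {m t : ℕ}

/-- The number of edges of `F` that end at `v`. -/
def inCount (F : Finset (Fin (t - 1) × Fin m)) (G : Graph m t) (v : ℕ) : ℕ :=
  (F.filter fun e => (G e : ℕ) = v).card

/-- The number of edges of `F` that start after `v` and end before `v`. -/
def jumpCount (F : Finset (Fin (t - 1) × Fin m)) (G : Graph m t) (v : ℕ) : ℕ :=
  (F.filter fun e => (G e : ℕ) < v ∧ v ≤ (e.1 : ℕ)).card

theorem inCount_insert {F : Finset (Fin (t - 1) × Fin m)} {e : Fin (t - 1) × Fin m} (he : e ∉ F)
    (G : Graph m t) (v : ℕ) :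
    inCount (insert e F) G v = inCount F G v + if v = G e then 1 else 0 := by
  unfold inCount
  rw [Finset.filter_insert]
  by_cases h : v = G e
  · rw [if_pos h.symm, if_pos h, Finset.card_insert_of_notMem (by simp [he])]
  · rw [if_neg (Ne.symm h), if_neg h, add_zero]

theorem jumpCount_insert {F : Finset (Fin (t - 1) × Fin m)} {e : Fin (t - 1) × Fin m}
    (he : e ∉ F) (G : Graph m t) (v : ℕ) :
    jumpCount (insert e F) G v =
      jumpCount F G v + if v ∈ Finset.Ioc (G e : ℕ) e.1 then 1 else 0 := by
  unfold jumpCount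
  rw [Finset.filter_insert]
  by_cases h : (G e : ℕ) < v ∧ v ≤ e.1
  · rw [if_pos h, if_pos (Finset.mem_Ioc.2 h), Finset.card_insert_of_notMem (by simp [he])]
  · rw [if_neg h, if_neg (mt Finset.mem_Ioc.1 h), add_zero]

theorem inCount_update {F : Finset (Fin (t - 1) × Fin m)} {e : Fin (t - 1) × Fin m} (he : e ∉ F)
    (G : Graph m t) (a : Fin (e.1 + 1)) (v : ℕ) :
    inCount F (Function.update G e a) v = inCount F G v := by
  unfold inCount
  congr 1
  refine Finset.filter_congr fun f hf => ?_
  rw [Function.update_of_ne (ne_of_mem_of_not_mem hf he)]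

theorem jumpCount_update {F : Finset (Fin (t - 1) × Fin m)} {e : Fin (t - 1) × Fin m} (he : e ∉ F)
    (G : Graph m t) (a : Fin (e.1 + 1)) (v : ℕ) :
    jumpCount F (Function.update G e a) v = jumpCount F G v := by
  unfold jumpCount
  congr 1
  refine Finset.filter_congr fun f hf => ?_
  rw [Function.update_of_ne (ne_of_mem_of_not_mem hf he)]

/-- The probability that the edges of `F` end where they do in `G` (see `sum_weight_filter`). -/
noncomputable def edgeProb (δ : ℝ) (F : Finset (Fin (t - 1) × Fin m)) (G : Graph m t) : ℝ :=
  ∏ v ∈ Finset.range t, urnMoment m δ v (inCount F G v) (jumpCount F G v)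

/-- The conditional probability that an edge of the vertex `n + 1` ends at `u`, given the edges
of `F`, which need not be the first ones. -/
noncomputable def stickProb (δ : ℝ) (F : Finset (Fin (t - 1) × Fin m)) (G : Graph m t)
    (n u : ℕ) : ℝ :=
  urnHit m δ u (inCount F G u) (jumpCount F G u) *
    ∏ w ∈ Finset.Ioc u n, urnMiss m δ w (inCount F G w) (jumpCount F G w)

theorem edgeProb_insert (δ : ℝ) {F : Finset (Fin (t - 1) × Fin m)} {e : Fin (t - 1) × Fin m}
    (he : e ∉ F) (G : Graph m t) :
    edgeProb δ (insert e F) G = edgeProb δ F G * stickProb δ F G e.1 (G e) := by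
  have h1 : (G e : ℕ) < e.1 + 1 := (G e).2
  have h2 : (e.1 : ℕ) < t - 1 := e.1.2
  have key : ∀ v, urnMoment m δ v (inCount (insert e F) G v) (jumpCount (insert e F) G v) =
      urnMoment m δ v (inCount F G v) (jumpCount F G v) *
      ((if v = G e then urnHit m δ v (inCount F G v) (jumpCount F G v) else 1) *
      (if v ∈ Finset.Ioc (G e : ℕ) e.1 then urnMiss m δ v (inCount F G v) (jumpCount F G v)
        else 1)) := by
    intro v
    rw [inCount_insert he, jumpCount_insert he]
    by_cases hv : v = G e
    · have : v ∉ Finset.Ioc (G e : ℕ) e.1 := by simp [hv]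
      rw [if_pos hv, if_neg this, if_pos hv, if_neg this, add_zero, mul_one, urnMoment_succ_left]
    · by_cases hw : v ∈ Finset.Ioc (G e : ℕ) e.1
      · have : v ≠ 0 := by
          have := Finset.mem_Ioc.1 hw
          omega
        rw [if_neg hv, if_pos hw, if_neg hv, if_pos hw, add_zero, one_mul,
          urnMoment_succ_right _ _ this]
      · simp [hv, hw]
  unfold edgeProb stickProb
  rw [Finset.prod_congr rfl fun v _ => key v, Finset.prod_mul_distrib, Finset.prod_mul_distrib,
    Finset.prod_ite_eq', if_pos (Finset.mem_range.2 (by omega)), Finset.prod_ite_mem,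
    Finset.inter_eq_right.2]
  intro v hv
  have := Finset.mem_Ioc.1 hv
  exact Finset.mem_range.2 (by omega)

theorem sum_stickProb {δ : ℝ} (hδ : -(m : ℝ) < δ) (F : Finset (Fin (t - 1) × Fin m))
    (G : Graph m t) (n : ℕ) : ∑ u : Fin (n + 1), stickProb δ F G n u = 1 :=
  sum_stick (x := fun u => urnHit m δ u (inCount F G u) (jumpCount F G u))
    (y := fun u => urnMiss m δ u (inCount F G u) (jumpCount F G u)) (by simp [urnHit])
    (fun _ => urnHit_add_urnMiss hδ _ _ _) n

theorem edgeProb_eq_sum {δ : ℝ} (hδ : -(m : ℝ) < δ) {F : Finset (Fin (t - 1) × Fin m)}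
    {e : Fin (t - 1) × Fin m} (he : e ∉ F) (G : Graph m t) :
    edgeProb δ F G = ∑ a, edgeProb δ (insert e F) (Function.update G e a) := by
  have h : ∀ a, edgeProb δ (insert e F) (Function.update G e a) =
      edgeProb δ F G * stickProb δ F G e.1 a := by
    intro a
    rw [edgeProb_insert δ he, Function.update_self]
    simp only [edgeProb, stickProb, inCount_update he, jumpCount_update he]
  rw [Finset.sum_congr rfl fun a _ => h a, ← Finset.mul_sum, sum_stickProb hδ, mul_one]

open Classical in
/-- The edges that are attached before `e`. -/
noncomputable def edgesBefore (e : Fin (t - 1) × Fin m) : Finset (Fin (t - 1) × Fin m) :=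
  Finset.univ.filter fun f => Before f e

theorem mem_edgesBefore {e f : Fin (t - 1) × Fin m} : f ∈ edgesBefore e ↔ Before f e := by
  simp [edgesBefore]

open Classical in
theorem card_filter_edgesBefore (e : Fin (t - 1) × Fin m) {v : ℕ} (hv : v < e.1) :
    ((edgesBefore e).filter fun f => (f.1 : ℕ) = v).card = m := by
  have h2 : v < t - 1 := hv.trans e.1.2
  have : (edgesBefore e).filter (fun f => (f.1 : ℕ) = v) =
      ({⟨v, h2⟩} : Finset (Fin (t - 1))) ×ˢ (Finset.univ : Finset (Fin m)) := by
    ext f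
    simp only [Finset.mem_filter, mem_edgesBefore, Finset.mem_product, Finset.mem_singleton,
      Finset.mem_univ, and_true, Fin.ext_iff]
    refine ⟨fun h => h.2, fun h => ⟨Or.inl (Fin.lt_def.2 (by omega)), h⟩⟩
  rw [this]
  simp

/-- Every vertex `v` sends `m` edges to older vertices. -/
theorem inCount_add_jumpCount (e : Fin (t - 1) × Fin m) (G : Graph m t) {v : ℕ} (hv : v < e.1) :
    inCount (edgesBefore e) G v + jumpCount (edgesBefore e) G v =
      m + jumpCount (edgesBefore e) G (v + 1) := by
  classical
  refine Eq.trans ?_ (congrArg (· + _) (card_filter_edgesBefore e hv))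
  unfold inCount jumpCount
  rw [← Finset.card_union_of_disjoint, ← Finset.card_union_of_disjoint]
  · congr 1
    ext f
    have h := (G f).2
    simp only [Finset.mem_union, Finset.mem_filter]
    by_cases hf : f ∈ edgesBefore e
    · simp only [hf, true_and]
      omega
    · simp [hf]
  · rw [Finset.disjoint_left]
    intro f h1 h2
    simp only [Finset.mem_filter] at h1 h2
    omega
  · rw [Finset.disjoint_left]
    intro f h1 h2
    simp only [Finset.mem_filter] at h1 h2
    omega

theorem inCount_add_jumpCount_self (e : Fin (t - 1) × Fin m) (G : Graph m t) :
    inCount (edgesBefore e) G e.1 + jumpCount (edgesBefore e) G e.1 = e.2 := by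
  classical
  unfold inCount jumpCount
  rw [← Finset.card_union_of_disjoint]
  · have : (edgesBefore e).filter (fun f => (G f : ℕ) = e.1) ∪
        (edgesBefore e).filter (fun f => (G f : ℕ) < e.1 ∧ (e.1 : ℕ) ≤ f.1) =
        ({e.1} : Finset (Fin (t - 1))) ×ˢ Finset.Iio e.2 := by
      ext f
      have h := (G f).2
      simp only [Finset.mem_union, Finset.mem_filter, mem_edgesBefore, Finset.mem_product,
        Finset.mem_singleton, Finset.mem_Iio, Before, Fin.ext_iff, Fin.lt_def]
      omega
    rw [this]
    simp
  · rw [Finset.disjoint_left]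
    intro f h1 h2
    simp only [Finset.mem_filter] at h1 h2
    omega

theorem degBefore_eq (e : Fin (t - 1) × Fin m) (G : Graph m t) {u : ℕ} (hu : u ≤ e.1) :
    degBefore G e u = (if u = 0 then 0 else m) + inCount (edgesBefore e) G u := by
  classical
  unfold degBefore inCount
  congr 1
  · split_ifs with h
    · simp [h]
    · refine Eq.trans ?_ (card_filter_edgesBefore e (v := u - 1) (by omega))
      congr 1
      ext f
      simp only [Finset.mem_filter, Finset.mem_univ, true_and, mem_edgesBefore]
      refine and_congr_right fun _ => ?_
      omega
  · congr 1
    ext f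
    simp [mem_edgesBefore]

/-- For the edges attached so far, stick breaking is the preferential attachment rule. The total
weight `T v` of the vertices up to `v` makes the product telescope. -/
theorem stickProb_edgesBefore {δ : ℝ} (hδ : -(m : ℝ) < δ) (G : Graph m t)
    (e : Fin (t - 1) × Fin m) : stickProb δ (edgesBefore e) G e.1 (G e) = attachProb δ G e (G e) := by
  have hu : (G e : ℕ) ≤ e.1 := Nat.lt_succ_iff.1 (G e).2
  unfold attachProb stickProb
  split_ifs with he
  · have : (G e : ℕ) = 0 := by omega
    simp [this, he, urnHit]
  set p := inCount (edgesBefore e) G with hp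
  set q := jumpCount (edgesBefore e) G with hq
  set u := (G e : ℕ) with hu'
  set T : ℕ → ℝ := fun v => 2 * (m : ℝ) * v + (v + 1) * δ + (p v + q v : ℕ) with hT
  have hT1 : ∀ w : ℕ, w ≠ 0 → w ≤ e.1 → (m : ℝ) * (2 * w - 1) + w * δ + q w = T (w - 1) := by
    intro w hw hwe
    obtain ⟨v, rfl⟩ := Nat.exists_eq_succ_of_ne_zero hw
    have h := inCount_add_jumpCount e G (v := v) (by omega)
    rw [← hp, ← hq] at h
    simp only [hT, Nat.succ_eq_add_one, Nat.add_sub_cancel, h]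
    push_cast
    ring
  have hpos : ∀ v : ℕ, v ≤ e.1 → T v ≠ 0 := by
    intro v hv
    rcases Nat.eq_zero_or_pos v with rfl | h
    · have := hT1 1 one_ne_zero (by omega)
      rw [Nat.sub_self] at this
      rw [← this]
      exact (older_pos hδ one_ne_zero _).ne'
    · exact (total_pos hδ h.ne' _).ne'
  have hprod : ∏ w ∈ Finset.Ioc u e.1, urnMiss m δ w (p w) (q w) = T u / T e.1 := by
    rw [← prod_telescope hu fun v _ h => hpos v h]
    refine Finset.prod_congr rfl fun w hw => ?_
    have hw' := Finset.mem_Ioc.1 hw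
    rw [urnMiss, if_neg (by omega), hT1 w (by omega) hw'.2]
  have hTe : T e.1 = 2 * (m : ℝ) * (e.1 : ℕ) + (e.2 : ℕ) + (((e.1 : ℕ) : ℝ) + 1) * δ := by
    simp only [hT, hp, hq, inCount_add_jumpCount_self]
    ring
  have hhit : urnHit m δ u (p u) (q u) * T u = degBefore G e u + δ := by
    rw [degBefore_eq e G hu, ← hp]
    unfold urnHit
    split_ifs with h0
    · have hq0 : q 0 = 0 := by simp [hq, jumpCount]
      simp only [hT, h0, hq0]
      push_cast
      ring
    · rw [div_mul_cancel₀ _ (hpos u hu)]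
      push_cast
      ring
  rw [hprod, ← hTe, mul_div_assoc', hhit]

/-- The position of an edge in the order of attachment. -/
def edgeRank (e : Fin (t - 1) × Fin m) : ℕ := m * e.1 + e.2

theorem before_iff_edgeRank_lt {f e : Fin (t - 1) × Fin m} :
    Before f e ↔ edgeRank f < edgeRank e := by
  have h1 := f.2.2
  have h2 := e.2.2
  unfold Before edgeRank
  rw [Fin.lt_def, Fin.lt_def, Fin.ext_iff]
  constructor
  · rintro (h | ⟨h, h'⟩)
    · have : m * ((f.1 : ℕ) + 1) ≤ m * (e.1 : ℕ) := Nat.mul_le_mul_left _ h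
      rw [mul_add] at this
      omega
    · rw [h]
      omega
  · intro h
    rcases lt_trichotomy (f.1 : ℕ) e.1 with h3 | h3 | h3
    · exact Or.inl h3
    · rw [h3] at h
      exact Or.inr ⟨h3, by omega⟩
    · have : m * ((e.1 : ℕ) + 1) ≤ m * (f.1 : ℕ) := Nat.mul_le_mul_left _ h3
      rw [mul_add] at this
      omega

theorem edgeRank_injective : Function.Injective (edgeRank : Fin (t - 1) × Fin m → ℕ) := by
  intro e f h
  have h1 : ¬ Before f e := by rw [before_iff_edgeRank_lt]; omega
  have h2 : ¬ Before e f := by rw [before_iff_edgeRank_lt]; omega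
  unfold Before at h1 h2
  push Not at h1 h2
  have h3 : e.1 = f.1 := le_antisymm h1.1 h2.1
  exact Prod.ext h3 (le_antisymm (h1.2 h3.symm) (h2.2 h3))

theorem weight_eq_edgeProb {δ : ℝ} (hδ : -(m : ℝ) < δ) (G : Graph m t) :
    weight δ G = edgeProb δ Finset.univ G := by
  have key : ∀ n, ∏ e ∈ Finset.univ.filter (fun e : Fin (t - 1) × Fin m => edgeRank e < n),
      attachProb δ G e (G e) =
      edgeProb δ (Finset.univ.filter fun e : Fin (t - 1) × Fin m => edgeRank e < n) G := by
    intro n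
    induction n with
    | zero => simp [edgeProb, inCount, jumpCount, urnMoment_zero_zero]
    | succ n ih =>
      by_cases h : ∃ e : Fin (t - 1) × Fin m, edgeRank e = n
      · obtain ⟨e, rfl⟩ := h
        have h1 : (Finset.univ.filter fun f : Fin (t - 1) × Fin m => edgeRank f < edgeRank e) =
            edgesBefore e := by
          ext f
          simp [mem_edgesBefore, before_iff_edgeRank_lt]
        have h2 : (Finset.univ.filter fun f : Fin (t - 1) × Fin m => edgeRank f < edgeRank e + 1) =
            insert e (edgesBefore e) := by
          ext f
          simp only [Finset.mem_filter, Finset.mem_univ, true_and, Finset.mem_insert,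
            mem_edgesBefore, before_iff_edgeRank_lt, ← edgeRank_injective.eq_iff]
          omega
        have h3 : e ∉ edgesBefore e := by simp [mem_edgesBefore, before_irrefl]
        rw [h1] at ih
        rw [h2, Finset.prod_insert h3, edgeProb_insert δ h3, ih, stickProb_edgesBefore hδ,
          mul_comm]
      · have : (Finset.univ.filter fun f : Fin (t - 1) × Fin m => edgeRank f < n + 1) =
            Finset.univ.filter fun f : Fin (t - 1) × Fin m => edgeRank f < n := by
          refine Finset.filter_congr fun f _ => ?_
          have : edgeRank f ≠ n := fun h' => h ⟨f, h'⟩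
          omega
        rw [this, ih]
  have := key (Finset.univ.sup (edgeRank : Fin (t - 1) × Fin m → ℕ) + 1)
  rwa [Finset.filter_true_of_mem fun e _ => Nat.lt_succ_iff.2 (Finset.le_sup (Finset.mem_univ e))]
    at this

/-- The joint law of the ends of the edges in `F`. -/
theorem sum_weight_filter {δ : ℝ} (hδ : -(m : ℝ) < δ) (F : Finset (Fin (t - 1) × Fin m))
    (G₀ : Graph m t) :
    ∑ G ∈ Finset.univ.filter (fun G : Graph m t => ∀ e ∈ F, G e = G₀ e), weight δ G =
      edgeProb δ F G₀ := by
  induction h : Fᶜ.card generalizing F G₀ with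
  | zero =>
    have hF : F = Finset.univ := by rwa [Finset.card_eq_zero, Finset.compl_eq_empty_iff] at h
    subst hF
    have : Finset.univ.filter (fun G : Graph m t => ∀ e ∈ Finset.univ, G e = G₀ e) = {G₀} := by
      ext G
      simp [funext_iff]
    rw [this, Finset.sum_singleton, weight_eq_edgeProb hδ]
  | succ n ih =>
    obtain ⟨e, he⟩ := Finset.card_pos.1 (by omega : 0 < Fᶜ.card)
    have he' : e ∉ F := Finset.mem_compl.1 he
    rw [edgeProb_eq_sum hδ he', ← Finset.sum_fiberwise _ fun G => G e]
    refine Finset.sum_congr rfl fun a _ => ?_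
    rw [← ih]
    · rw [Finset.filter_filter]
      refine Finset.sum_congr (Finset.filter_congr fun G _ => ?_) fun _ _ => rfl
      rw [Finset.forall_mem_insert, Function.update_self, and_comm]
      refine and_congr_right fun _ => forall₂_congr fun f hf => ?_
      rw [Function.update_of_ne (ne_of_mem_of_not_mem hf he')]
    · rw [Finset.compl_insert, Finset.card_erase_of_mem he, h, Nat.add_sub_cancel]

end

/-! ### Sums over increasing tuples -/

theorem tendsto_mul_pow_sub_one {c X : ℕ → ℝ} {x : ℝ} (hX : Tendsto X atTop (𝓝 1))
    (h : Tendsto (fun n => c n * (X n - 1)) atTop (𝓝 x)) (j : ℕ) :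
    Tendsto (fun n => c n * (X n ^ j - 1)) atTop (𝓝 (j * x)) := by
  induction j with
  | zero => simp
  | succ j ih =>
    have := (ih.mul hX).add h
    convert this using 2
    · ring
    · push_cast
      ring

theorem tendsto_mul_log_succ_sub :
    Tendsto (fun n : ℕ => (n : ℝ) * (Real.log (n + 1) - Real.log n)) atTop (𝓝 1) := by
  refine ((Real.tendsto_mul_log_one_add_div_atTop 1).comp tendsto_natCast_atTop_atTop).congr' ?_
  filter_upwards [eventually_gt_atTop 0] with n hn
  have hn' : (0 : ℝ) < n := by exact_mod_cast hn
  simp only [Function.comp]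
  rw [← Real.log_div (by positivity) hn'.ne']
  congr 2
  field_simp

theorem tendsto_log_natCast : Tendsto (fun n : ℕ => Real.log n) atTop atTop :=
  Real.tendsto_log_atTop.comp tendsto_natCast_atTop_atTop

theorem tendsto_mul_log_ratio_sub_one :
    Tendsto (fun n : ℕ => ((n : ℝ) * Real.log n) * (Real.log (n + 1) / Real.log n - 1))
      atTop (𝓝 1) := by
  refine tendsto_mul_log_succ_sub.congr' ?_
  filter_upwards [tendsto_log_natCast.eventually_gt_atTop 0] with n hn
  field_simp

theorem tendsto_mul_log_ratio_sub_one' :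
    Tendsto (fun n : ℕ => (n : ℝ) * (Real.log (n + 1) / Real.log n - 1)) atTop (𝓝 0) := by
  have := tendsto_mul_log_ratio_sub_one.mul (tendsto_inv_atTop_zero.comp tendsto_log_natCast)
  rw [one_mul] at this
  refine this.congr' ?_
  filter_upwards [tendsto_log_natCast.eventually_gt_atTop 0] with n hn
  simp only [Function.comp]
  field_simp

theorem tendsto_of_tendsto_mul_sub_one {X : ℕ → ℝ} {x : ℝ}
    (h : Tendsto (fun n : ℕ => (n : ℝ) * (X n - 1)) atTop (𝓝 x)) : Tendsto X atTop (𝓝 1) := by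
  have := (h.mul (tendsto_inv_atTop_nhds_zero_nat (𝕜 := ℝ))).add_const 1
  rw [mul_zero, zero_add] at this
  refine this.congr' ?_
  filter_upwards [eventually_gt_atTop 0] with n hn
  have hn' : (0 : ℝ) < n := by exact_mod_cast hn
  field_simp
  ring

theorem tendsto_mul_rpow_ratio_sub_one (a : ℝ) :
    Tendsto (fun n : ℕ => (n : ℝ) * (((n : ℝ) + 1) ^ a / (n : ℝ) ^ a - 1)) atTop (𝓝 a) := by
  have h := hasDerivAt_iff_tendsto_slope_zero.1
    (Real.hasDerivAt_rpow_const (x := 1) (p := a) (Or.inl one_ne_zero))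
  simp only [Real.one_rpow, mul_one] at h
  have h2 : Tendsto (fun n : ℕ => ((n : ℝ))⁻¹) atTop (𝓝[≠] 0) := by
    refine tendsto_nhdsWithin_iff.2 ⟨tendsto_inv_atTop_nhds_zero_nat, ?_⟩
    filter_upwards [eventually_gt_atTop 0] with n hn
    simpa using hn.ne'
  refine (h.comp h2).congr' ?_
  filter_upwards [eventually_gt_atTop 0] with n hn
  have hn' : (0 : ℝ) < n := by exact_mod_cast hn
  simp only [Function.comp, inv_inv, smul_eq_mul]
  rw [← Real.div_rpow (by positivity) hn'.le]
  congr 3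
  field_simp

/-- The Stolz–Cesàro theorem. -/
theorem tendsto_sum_div_of_tendsto_div_sub {u F : ℕ → ℝ} {C : ℝ} (hmono : Monotone F)
    (hF : Tendsto F atTop atTop) (hpos : ∀ᶠ n in atTop, F n < F (n + 1))
    (h : Tendsto (fun n => u n / (F (n + 1) - F n)) atTop (𝓝 C)) :
    Tendsto (fun t => (∑ n ∈ Finset.range t, u n) / F t) atTop (𝓝 C) := by
  have h1 : (fun n => u n - C * (F (n + 1) - F n)) =o[atTop] fun n => F (n + 1) - F n := by
    refine (Asymptotics.isLittleO_iff_tendsto' ?_).2 ?_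
    · filter_upwards [hpos] with n hn h0
      linarith
    · have := h.sub_const C
      rw [sub_self] at this
      refine this.congr' ?_
      filter_upwards [hpos] with n hn
      have : F (n + 1) - F n ≠ 0 := by linarith
      field_simp
  have h2 : ∀ t, ∑ n ∈ Finset.range t, (F (n + 1) - F n) = F t - F 0 := fun t =>
    Finset.sum_range_sub F t
  have h3 := h1.sum_range (fun n => sub_nonneg.2 (hmono n.le_succ)) (by
    simp only [h2]
    exact tendsto_atTop_add_const_right _ _ hF)
  simp only [h2, Finset.sum_sub_distrib, ← Finset.mul_sum] at h3
  have h4 : (fun t => F t - F 0) =O[atTop] F := by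
    refine (Asymptotics.isBigO_refl F atTop).sub ?_
    exact ((Asymptotics.isLittleO_const_left.2 (Or.inr (tendsto_norm_atTop_atTop.comp hF))).isBigO)
  have h5 := (h3.trans_isBigO h4).tendsto_div_nhds_zero
  have h6 : Tendsto (fun t => C * F 0 / F t) atTop (𝓝 0) := hF.const_div_atTop _
  have h7 := (h5.sub h6).add_const C
  rw [sub_zero, zero_add] at h7
  refine h7.congr' ?_
  filter_upwards [hF.eventually_gt_atTop 0] with t ht
  field_simp
  ring

/-- The bound `l = 0 → 0 < a` excludes the constant function. -/
theorem tendsto_rpow_mul_log_pow {a : ℝ} {l : ℕ} (ha : 0 ≤ a) (hl : l = 0 → 0 < a) :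
    Tendsto (fun n : ℕ => (n : ℝ) ^ a * Real.log n ^ l) atTop atTop := by
  rcases Nat.eq_zero_or_pos l with rfl | h
  · simpa [Function.comp_def] using
      (tendsto_rpow_atTop (hl rfl)).comp (tendsto_natCast_atTop_atTop (R := ℝ))
  · refine tendsto_atTop_mono' _ ?_ ((tendsto_pow_atTop h.ne').comp tendsto_log_natCast)
    filter_upwards [eventually_gt_atTop 0] with n hn
    have hn' : (1 : ℝ) ≤ n := by exact_mod_cast hn
    exact le_mul_of_one_le_left (pow_nonneg (Real.log_natCast_nonneg n) _) (Real.one_le_rpow hn' ha)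

theorem monotone_rpow_mul_log_pow {a : ℝ} (ha : 0 ≤ a) (l : ℕ) :
    Monotone fun n : ℕ => (n : ℝ) ^ a * Real.log n ^ l := by
  refine monotone_nat_of_le_succ fun n => ?_
  have h1 : (n : ℝ) ≤ (n + 1 : ℕ) := by exact_mod_cast n.le_succ
  refine mul_le_mul (Real.rpow_le_rpow (Nat.cast_nonneg _) h1 ha)
    (pow_le_pow_left₀ (Real.log_natCast_nonneg n) ?_ _) (pow_nonneg (Real.log_natCast_nonneg n) _)
    (by positivity)
  rcases Nat.eq_zero_or_pos n with rfl | h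
  · simp
  · exact Real.log_le_log (by exact_mod_cast h) h1

theorem tendsto_sum_of_pos {u : ℕ → ℝ} {a C : ℝ} {l : ℕ} (ha : 0 < a)
    (h : Tendsto (fun n : ℕ => u n / ((n : ℝ) ^ (a - 1) * Real.log n ^ l)) atTop (𝓝 C)) :
    Tendsto (fun t : ℕ => (∑ n ∈ Finset.range t, u n) / ((t : ℝ) ^ a * Real.log t ^ l))
      atTop (𝓝 (C / a)) := by
  have hX := tendsto_mul_rpow_ratio_sub_one a
  have hL := tendsto_mul_pow_sub_one (tendsto_of_tendsto_mul_sub_one tendsto_mul_log_ratio_sub_one')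
    tendsto_mul_log_ratio_sub_one' l
  have hL1 := (tendsto_of_tendsto_mul_sub_one tendsto_mul_log_ratio_sub_one').pow l
  have hd := (hX.mul hL1).add hL
  rw [one_pow, mul_one, mul_zero, add_zero] at hd
  have hd' : Tendsto (fun n : ℕ => (((n + 1 : ℕ) : ℝ) ^ a * Real.log ((n + 1 : ℕ) : ℝ) ^ l -
      (n : ℝ) ^ a * Real.log n ^ l) / ((n : ℝ) ^ (a - 1) * Real.log n ^ l)) atTop (𝓝 a) := by
    refine hd.congr' ?_
    filter_upwards [tendsto_log_natCast.eventually_gt_atTop 0, eventually_gt_atTop 0] with n hn hn0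
    have hn' : (0 : ℝ) < n := by exact_mod_cast hn0
    have hp : (0 : ℝ) < (n : ℝ) ^ a := Real.rpow_pos_of_pos hn' a
    rw [Real.rpow_sub_one hn'.ne', div_pow]
    push_cast
    field_simp
    ring
  refine tendsto_sum_div_of_tendsto_div_sub (monotone_rpow_mul_log_pow ha.le l)
    (tendsto_rpow_mul_log_pow ha.le fun _ => ha) ?_ ?_
  · filter_upwards [hd'.eventually_const_lt ha, tendsto_log_natCast.eventually_gt_atTop 0,
      eventually_gt_atTop 0] with n hn hlog hn0
    have hn' : (0 : ℝ) < n := by exact_mod_cast hn0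
    exact sub_pos.1 ((div_pos_iff_of_pos_right (by positivity)).1 hn)
  · refine (h.div hd' ha.ne').congr' ?_
    filter_upwards [tendsto_log_natCast.eventually_gt_atTop 0,
      eventually_gt_atTop 0] with n hlog hn0
    have hn' : (0 : ℝ) < n := by exact_mod_cast hn0
    exact div_div_div_cancel_right₀ (by positivity) _ _

theorem tendsto_sum_of_zero {u : ℕ → ℝ} {C : ℝ} {l : ℕ}
    (h : Tendsto (fun n : ℕ => u n / ((n : ℝ) ^ (-1 : ℝ) * Real.log n ^ l)) atTop (𝓝 C)) :
    Tendsto (fun t : ℕ => (∑ n ∈ Finset.range t, u n) / ((t : ℝ) ^ (0 : ℝ) * Real.log t ^ (l + 1)))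
      atTop (𝓝 (C / (l + 1))) := by
  have hl : (0 : ℝ) < (l : ℝ) + 1 := by positivity
  have hd := tendsto_mul_pow_sub_one
    (tendsto_of_tendsto_mul_sub_one tendsto_mul_log_ratio_sub_one')
    tendsto_mul_log_ratio_sub_one (l + 1)
  rw [mul_one] at hd
  push_cast at hd
  have hd' : Tendsto (fun n : ℕ => (((n + 1 : ℕ) : ℝ) ^ (0 : ℝ) *
      Real.log ((n + 1 : ℕ) : ℝ) ^ (l + 1) - (n : ℝ) ^ (0 : ℝ) * Real.log n ^ (l + 1)) /
      ((n : ℝ) ^ (-1 : ℝ) * Real.log n ^ l)) atTop (𝓝 (l + 1)) := by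
    refine hd.congr' ?_
    filter_upwards [tendsto_log_natCast.eventually_gt_atTop 0, eventually_gt_atTop 0] with n hn hn0
    have hn' : (0 : ℝ) < n := by exact_mod_cast hn0
    rw [Real.rpow_zero, Real.rpow_zero, Real.rpow_neg_one, div_pow]
    push_cast
    field_simp
    ring
  refine tendsto_sum_div_of_tendsto_div_sub (monotone_rpow_mul_log_pow le_rfl (l + 1))
    (tendsto_rpow_mul_log_pow le_rfl fun h => absurd h (Nat.succ_ne_zero l)) ?_ ?_
  · filter_upwards [hd'.eventually_const_lt hl, tendsto_log_natCast.eventually_gt_atTop 0,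
      eventually_gt_atTop 0] with n hn hlog hn0
    have hn' : (0 : ℝ) < n := by exact_mod_cast hn0
    exact sub_pos.1 ((div_pos_iff_of_pos_right (by positivity)).1 hn)
  · refine (h.div hd' hl.ne').congr' ?_
    filter_upwards [tendsto_log_natCast.eventually_gt_atTop 0,
      eventually_gt_atTop 0] with n hlog hn0
    have hn' : (0 : ℝ) < n := by exact_mod_cast hn0
    exact div_div_div_cancel_right₀ (by positivity) _ _

theorem tendsto_sum_of_neg {u : ℕ → ℝ} {a C : ℝ} {l : ℕ} (ha : a < 0) (hu : ∀ n, 0 ≤ u n)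
    (hC : 0 < C)
    (h : Tendsto (fun n : ℕ => u n / ((n : ℝ) ^ (a - 1) * Real.log n ^ l)) atTop (𝓝 C)) :
    ∃ L, 0 < L ∧ Tendsto (fun t : ℕ => ∑ n ∈ Finset.range t, u n) atTop (𝓝 L) := by
  have hlog : ∀ᶠ n : ℕ in atTop, 0 < (n : ℝ) ^ (a - 1) * Real.log n ^ l := by
    filter_upwards [tendsto_log_natCast.eventually_gt_atTop 0,
      eventually_gt_atTop 0] with n hlog hn0
    have hn' : (0 : ℝ) < n := by exact_mod_cast hn0
    positivity
  have h1 : u =O[atTop] fun n : ℕ => (n : ℝ) ^ (a - 1) * Real.log n ^ l := by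
    refine Asymptotics.isBigO_of_div_tendsto_nhds ?_ C h
    filter_upwards [hlog] with n hn h0
    exact absurd h0 hn.ne'
  have h2 : (fun n : ℕ => Real.log n ^ l) =o[atTop] fun n : ℕ => (n : ℝ) ^ (-(a / 2)) := by
    have := (isLittleO_log_rpow_rpow_atTop (l : ℝ) (by linarith : 0 < -(a / 2))).comp_tendsto
      tendsto_natCast_atTop_atTop
    simpa [Function.comp_def] using this
  have h3 : (fun n : ℕ => (n : ℝ) ^ (a - 1) * Real.log n ^ l) =O[atTop]
      fun n : ℕ => (n : ℝ) ^ (a / 2 - 1) := by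
    refine ((Asymptotics.isBigO_refl (fun n : ℕ => (n : ℝ) ^ (a - 1)) atTop).mul
      h2.isBigO).congr' EventuallyEq.rfl ?_
    filter_upwards [eventually_gt_atTop 0] with n hn0
    have hn' : (0 : ℝ) < n := by exact_mod_cast hn0
    rw [← Real.rpow_add hn']
    congr 1
    ring
  have hs : Summable u :=
    summable_of_isBigO_nat (Real.summable_nat_rpow.2 (by linarith)) (h1.trans h3)
  refine ⟨∑' n, u n, ?_, hs.hasSum.tendsto_sum_nat⟩
  obtain ⟨n, hn, hn'⟩ := ((h.eventually_const_lt hC).and hlog).exists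
  exact hs.tsum_pos hu n ((div_pos_iff_of_pos_right hn').1 hn)

/-- The sequence `f` is asymptotic to a positive multiple of `n ^ b`. -/
def HasPowerLaw (f : ℕ → ℝ) (b : ℝ) : Prop :=
  ∃ a, 0 < a ∧ Tendsto (fun n : ℕ => f n / (n : ℝ) ^ b) atTop (𝓝 a)

theorem HasPowerLaw.mul {f g : ℕ → ℝ} {b c : ℝ} (hf : HasPowerLaw f b) (hg : HasPowerLaw g c) :
    HasPowerLaw (fun n => f n * g n) (b + c) := by
  obtain ⟨x, hx, hf⟩ := hf
  obtain ⟨y, hy, hg⟩ := hg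
  refine ⟨x * y, mul_pos hx hy, (hf.mul hg).congr' ?_⟩
  filter_upwards [eventually_gt_atTop 0] with n hn
  rw [Real.rpow_add (by exact_mod_cast hn), div_mul_div_comm]

theorem HasPowerLaw.div {f g : ℕ → ℝ} {b c : ℝ} (hf : HasPowerLaw f b) (hg : HasPowerLaw g c) :
    HasPowerLaw (fun n => f n / g n) (b - c) := by
  obtain ⟨x, hx, hf⟩ := hf
  obtain ⟨y, hy, hg⟩ := hg
  refine ⟨x / y, div_pos hx hy, (hf.div hg hy.ne').congr' ?_⟩
  filter_upwards [eventually_gt_atTop 0] with n hn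
  rw [Real.rpow_sub (by exact_mod_cast hn), Pi.div_apply, div_div_div_comm]

theorem HasPowerLaw.congr' {f g : ℕ → ℝ} {b : ℝ} (hf : HasPowerLaw f b) (h : f =ᶠ[atTop] g) :
    HasPowerLaw g b := by
  obtain ⟨x, hx, hf⟩ := hf
  refine ⟨x, hx, hf.congr' ?_⟩
  filter_upwards [h] with n hn
  rw [hn]

theorem hasPowerLaw_zero {f : ℕ → ℝ} {a : ℝ} (ha : 0 < a) (h : Tendsto f atTop (𝓝 a)) :
    HasPowerLaw f 0 :=
  ⟨a, ha, by simpa using h⟩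

/-- The sum of `∏ i, w i (p i)` over all `p 0 < p 1 < ⋯ < p (k - 1) < t`, by recursion on the
largest entry (see `sum_strictMono`). -/
noncomputable def simplexSum (w : ℕ → ℕ → ℝ) : ℕ → ℕ → ℝ
  | 0, _ => 1
  | k + 1, t => ∑ n ∈ Finset.range t, w k n * simplexSum w k n

/-- The exponent of the part of the sum in which the first `s` of the `k` entries stay bounded and
the others are of the order of `t`. -/
noncomputable def splitExponent (b : ℕ → ℝ) (k s : ℕ) : ℝ := ∑ i ∈ Finset.Ico s k, (b i + 1)

theorem splitExponent_succ (b : ℕ → ℝ) {k s : ℕ} (h : s ≤ k) :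
    splitExponent b (k + 1) s = splitExponent b k s + (b k + 1) :=
  Finset.sum_Ico_succ_top h _

theorem simplexSum_nonneg {w : ℕ → ℕ → ℝ} (hw : ∀ i n, 0 ≤ w i n) (k t : ℕ) :
    0 ≤ simplexSum w k t := by
  induction k generalizing t with
  | zero => exact zero_le_one
  | succ k ih => exact Finset.sum_nonneg fun n _ => mul_nonneg (hw k n) (ih n)

/-- The sum over the largest entry raises the exponent, adds a logarithm, or converges,
according to the sign of `E + b k + 1`. -/
theorem tendsto_simplexSum {w : ℕ → ℕ → ℝ} {b : ℕ → ℝ} (hw : ∀ i n, 0 ≤ w i n)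
    (hb : ∀ i, HasPowerLaw (w i) (b i)) (k : ℕ)
    {E : ℝ} (hle : ∀ s, s ≤ k → splitExponent b k s ≤ E)
    (hex : ∃ s, s ≤ k ∧ splitExponent b k s = E) :
    ∃ C, 0 < C ∧ Tendsto (fun t : ℕ => simplexSum w k t / ((t : ℝ) ^ E * Real.log t ^
      (((Finset.range (k + 1)).filter fun s => splitExponent b k s = E).card - 1)))
      atTop (𝓝 C) := by
  induction k generalizing E with
  | zero =>
    obtain ⟨s, hs, rfl⟩ := hex
    obtain rfl : s = 0 := by omega
    refine ⟨1, one_pos, ?_⟩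
    simp [simplexSum, splitExponent]
  | succ k ih =>
    obtain ⟨s₀, hs₀, hmax⟩ := Finset.exists_max_image (Finset.range (k + 1)) (splitExponent b k)
      Finset.nonempty_range_add_one
    have hs₀' : s₀ ≤ k := Nat.lt_succ_iff.1 (Finset.mem_range.1 hs₀)
    set E' := splitExponent b k s₀ with hE'
    obtain ⟨C, hC, hlim⟩ := ih (E := E')
      (fun s hs => hmax s (Finset.mem_range.2 (Nat.lt_succ_iff.2 hs))) ⟨s₀, hs₀', rfl⟩
    set r := ((Finset.range (k + 1)).filter fun s => splitExponent b k s = E').card with hr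
    have hr1 : 0 < r := Finset.card_pos.2 ⟨s₀, Finset.mem_filter.2 ⟨hs₀, rfl⟩⟩
    obtain ⟨a, ha, hwlim⟩ := hb k
    set A := E' + (b k + 1) with hA
    have hu : Tendsto (fun n : ℕ => w k n * simplexSum w k n /
        ((n : ℝ) ^ (A - 1) * Real.log n ^ (r - 1))) atTop (𝓝 (a * C)) := by
      refine (hwlim.mul hlim).congr' ?_
      filter_upwards [eventually_gt_atTop 0] with n hn0
      have hn' : (0 : ℝ) < n := by exact_mod_cast hn0
      rw [div_mul_div_comm, ← mul_assoc, ← Real.rpow_add hn']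
      rw [show b k + E' = A - 1 by rw [hA]; ring]
    have hlast : splitExponent b (k + 1) (k + 1) = 0 := by simp [splitExponent]
    have hshift : ∀ s, s ≤ k → splitExponent b (k + 1) s = splitExponent b k s + (b k + 1) :=
      fun s hs => splitExponent_succ b hs
    have hE0 : 0 ≤ E := hlast ▸ hle (k + 1) le_rfl
    have hEA : A ≤ E := by
      have := hle s₀ (by omega)
      rwa [hshift s₀ hs₀'] at this
    have hEmax : E = 0 ∨ E ≤ A := by
      obtain ⟨s, hs, h⟩ := hex
      rcases Nat.lt_or_ge k s with h' | h'
      · obtain rfl : s = k + 1 := by omega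
        exact Or.inl (h.symm.trans hlast)
      · rw [hshift s h'] at h
        have := hmax s (Finset.mem_range.2 (by omega))
        exact Or.inr (by linarith)
    have hfilter : ((Finset.range (k + 1)).filter fun s => splitExponent b (k + 1) s = A) =
        (Finset.range (k + 1)).filter fun s => splitExponent b k s = E' := by
      refine Finset.filter_congr fun s hs => ?_
      rw [hshift s (Nat.lt_succ_iff.1 (Finset.mem_range.1 hs)), hA, add_left_inj]
    rcases lt_trichotomy A 0 with hneg | hzero | hpos
    · have hE : E = 0 := hEmax.elim id fun h => by linarith
      obtain ⟨L, hL, hLlim⟩ := tendsto_sum_of_neg hneg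
        (fun n => mul_nonneg (hw k n) (simplexSum_nonneg hw k n)) (mul_pos ha hC) hu
      refine ⟨L, hL, ?_⟩
      have hcard : ((Finset.range (k + 1 + 1)).filter
          fun s => splitExponent b (k + 1) s = E) = {k + 1} := by
        rw [Finset.range_add_one, Finset.filter_insert, if_pos (hlast.trans hE.symm),
          Finset.filter_eq_empty_iff.2, insert_empty_eq]
        intro s hs h
        have := hmax s hs
        rw [hshift s (Nat.lt_succ_iff.1 (Finset.mem_range.1 hs))] at h
        linarith
      rw [hcard, hE]
      simpa [simplexSum] using hLlim
    · have hE : E = 0 := hEmax.elim id fun h => by linarith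
      rw [hzero, zero_sub] at hu
      refine ⟨a * C / ((r - 1 : ℕ) + 1), by positivity, ?_⟩
      have hcard : ((Finset.range (k + 1 + 1)).filter
          fun s => splitExponent b (k + 1) s = E).card = r + 1 := by
        rw [Finset.range_add_one, Finset.filter_insert, if_pos (hlast.trans hE.symm), hE, ← hzero,
          hfilter, Finset.card_insert_of_notMem (by simp)]
      rw [hcard, hE, show r + 1 - 1 = r - 1 + 1 by omega]
      exact tendsto_sum_of_zero hu
    · have hE : E = A := le_antisymm (hEmax.elim (fun h => by linarith) id) hEA
      refine ⟨a * C / A, by positivity, ?_⟩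
      have hcard : ((Finset.range (k + 1 + 1)).filter
          fun s => splitExponent b (k + 1) s = E).card = r := by
        rw [Finset.range_add_one, Finset.filter_insert, if_neg (by rw [hlast]; linarith), hE,
          hfilter]
      rw [hcard, hE]
      exact tendsto_sum_of_pos hpos hu

/-! ### Asymptotics of the urn moments -/

theorem two_mul_add_pos {m : ℕ} {δ : ℝ} (hm : 1 ≤ m) (hδ : -(m : ℝ) < δ) :
    0 < 2 * (m : ℝ) + δ := by
  have : (1 : ℝ) ≤ m := by exact_mod_cast hm
  linarith

theorem hasPowerLaw_urnHit {m : ℕ} {δ : ℝ} (hm : 1 ≤ m) (hδ : -(m : ℝ) < δ) (p q : ℕ) :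
    HasPowerLaw (fun n => urnHit m δ n p q) (-1) := by
  have h2 := two_mul_add_pos hm hδ
  have h3 : 0 < (m : ℝ) + δ + p := by
    have := Nat.cast_nonneg (α := ℝ) p
    linarith
  refine ⟨((m : ℝ) + δ + p) / (2 * m + δ), by positivity, ?_⟩
  refine (tendsto_add_mul_div_add_mul_atTop_nhds 0 (δ + (p + q : ℕ)) ((m : ℝ) + δ + p)
    h2.ne').congr' ?_
  filter_upwards [eventually_gt_atTop 0] with n hn
  have hn' : (0 : ℝ) < n := by exact_mod_cast hn
  rw [urnHit, if_neg hn.ne', Real.rpow_neg_one, div_inv_eq_mul, div_mul_eq_mul_div, zero_add]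
  congr 1
  ring

theorem hasPowerLaw_urnMiss {m : ℕ} {δ : ℝ} (hm : 1 ≤ m) (hδ : -(m : ℝ) < δ) (p q : ℕ) :
    HasPowerLaw (fun n => urnMiss m δ n p q) 0 := by
  have h2 := two_mul_add_pos hm hδ
  refine hasPowerLaw_zero (div_pos h2 h2) ?_
  refine (tendsto_add_mul_div_add_mul_atTop_nhds (-(m : ℝ) + q) (δ + (p + q : ℕ)) (2 * (m : ℝ) + δ)
    h2.ne').congr' ?_
  filter_upwards [eventually_gt_atTop 0] with n hn
  rw [urnMiss, if_neg hn.ne']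
  congr 1 <;> ring

theorem hasPowerLaw_urnMoment {m : ℕ} {δ : ℝ} (hm : 1 ≤ m) (hδ : -(m : ℝ) < δ) (p q : ℕ) :
    HasPowerLaw (fun n => urnMoment m δ n p q) (-p) := by
  induction p with
  | zero =>
    rw [Nat.cast_zero, neg_zero]
    induction q with
    | zero =>
      refine hasPowerLaw_zero one_pos ?_
      simp [urnMoment_zero_zero]
    | succ q ih =>
      have := ih.mul (hasPowerLaw_urnMiss hm hδ 0 q)
      rw [add_zero] at this
      refine this.congr' ?_
      filter_upwards [eventually_gt_atTop 0] with n hn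
      rw [urnMoment_succ_right _ _ hn.ne']
  | succ p ih =>
    have := ih.mul (hasPowerLaw_urnHit hm hδ p q)
    push_cast
    rw [neg_add]
    exact this.congr' (Eventually.of_forall fun n => (urnMoment_succ_left m δ n p q).symm)

/-- Both products are values of Euler's limit formula for the Gamma function. -/
theorem hasPowerLaw_prod_ratio {x y : ℝ} (hx : 0 < x) (hy : 0 < y) :
    HasPowerLaw (fun n => ∏ j ∈ Finset.range n, (x + j) / (y + j)) (x - y) := by
  have h1 : HasPowerLaw (fun n => ∏ j ∈ Finset.range (n + 1), (x + j) / (y + j)) (x - y) := by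
    refine ⟨Real.Gamma y / Real.Gamma x, div_pos (Real.Gamma_pos_of_pos hy)
      (Real.Gamma_pos_of_pos hx), ?_⟩
    refine ((Real.GammaSeq_tendsto_Gamma y).div (Real.GammaSeq_tendsto_Gamma x)
      (Real.Gamma_pos_of_pos hx).ne').congr' ?_
    filter_upwards [eventually_gt_atTop 0] with n hn
    have hn' : (0 : ℝ) < n := by exact_mod_cast hn
    have hX : 0 < ∏ j ∈ Finset.range (n + 1), (x + j) :=
      Finset.prod_pos fun j _ => by positivity
    have hY : 0 < ∏ j ∈ Finset.range (n + 1), (y + j) :=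
      Finset.prod_pos fun j _ => by positivity
    have hnx : 0 < (n : ℝ) ^ x := Real.rpow_pos_of_pos hn' x
    have hny : 0 < (n : ℝ) ^ y := Real.rpow_pos_of_pos hn' y
    have hf : (0 : ℝ) < n.factorial := by exact_mod_cast n.factorial_pos
    rw [Finset.prod_div_distrib, Real.rpow_sub hn', Pi.div_apply]
    unfold Real.GammaSeq
    field_simp
  have h2 : HasPowerLaw (fun n : ℕ => (x + n) / (y + n)) 0 := by
    refine hasPowerLaw_zero (div_pos one_pos one_pos)
      ((tendsto_add_mul_div_add_mul_atTop_nhds x y 1 one_ne_zero).congr fun n => ?_)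
    simp
  have h3 := h1.div h2
  rw [sub_zero] at h3
  refine h3.congr' (Eventually.of_forall fun n => ?_)
  have : 0 < (x + n) / (y + n) := by positivity
  simp only [Finset.prod_range_succ]
  exact mul_div_cancel_right₀ _ this.ne'

/-- The probability that none of `c` given edges of vertices newer than `n` ends at one of
`1, …, n`. -/
noncomputable def passProb (m : ℕ) (δ : ℝ) (c n : ℕ) : ℝ :=
  ∏ v ∈ Finset.range (n + 1), urnMoment m δ v 0 c

theorem passProb_pos {m : ℕ} {δ : ℝ} (hδ : -(m : ℝ) < δ) (c n : ℕ) : 0 < passProb m δ c n :=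
  Finset.prod_pos fun v _ => urnMoment_pos hδ v 0 c

theorem passProb_succ {m : ℕ} {δ : ℝ} (c n : ℕ) :
    passProb m δ (c + 1) n =
      passProb m δ c n * ∏ v ∈ Finset.range n, urnMiss m δ (v + 1) 0 c := by
  unfold passProb
  rw [Finset.prod_range_succ', Finset.prod_range_succ',
    Finset.prod_congr rfl fun v _ => urnMoment_succ_right m δ (Nat.succ_ne_zero v) 0 c,
    Finset.prod_mul_distrib]
  simp [urnMoment]

theorem hasPowerLaw_passProb {m : ℕ} {δ : ℝ} (hm : 1 ≤ m) (hδ : -(m : ℝ) < δ) (c : ℕ) :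
    HasPowerLaw (passProb m δ c) (-((m + δ) / (2 * m + δ) * c)) := by
  have h2 := two_mul_add_pos hm hδ
  have hm' : (1 : ℝ) ≤ m := by exact_mod_cast hm
  induction c with
  | zero =>
    rw [Nat.cast_zero, mul_zero, neg_zero]
    refine hasPowerLaw_zero one_pos (tendsto_const_nhds.congr fun n => ?_)
    simp [passProb, urnMoment_zero_zero]
  | succ c ih =>
    have hc := Nat.cast_nonneg (α := ℝ) c
    have hx : 0 < ((m : ℝ) + δ + c) / (2 * m + δ) := div_pos (by linarith) h2
    have hy : 0 < (2 * (m : ℝ) + 2 * δ + c) / (2 * m + δ) := div_pos (by linarith) h2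
    have h := ih.mul (hasPowerLaw_prod_ratio hx hy)
    have hexp : -((m + δ) / (2 * m + δ) * (c : ℝ)) + (((m : ℝ) + δ + c) / (2 * m + δ) -
        (2 * (m : ℝ) + 2 * δ + c) / (2 * m + δ)) = -((m + δ) / (2 * m + δ) * (c + 1 : ℕ)) := by
      push_cast
      field_simp
      ring
    rw [hexp] at h
    refine h.congr' (Eventually.of_forall fun n => ?_)
    rw [passProb_succ]
    refine congrArg (passProb m δ c n * ·) ?_
    refine Finset.prod_congr rfl fun v _ => ?_
    rw [urnMiss, if_neg (Nat.succ_ne_zero v), ← mul_div_mul_right _ _ h2.ne', add_mul, add_mul,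
      div_mul_cancel₀ _ h2.ne', div_mul_cancel₀ _ h2.ne']
    congr 1
    · push_cast
      ring
    · push_cast
      ring

/-- The factor of the probability of a copy that belongs to its vertex `n`, if `d` edges of the
copy end at `n`, `q` edges pass over `n`, and `c` and `c'` edges pass over the gaps below and
above `n`. -/
noncomputable def vertexWeight (m : ℕ) (δ : ℝ) (d q c c' n : ℕ) : ℝ :=
  urnMoment m δ n d q / urnMoment m δ n 0 c * (passProb m δ c n / passProb m δ c' n)

theorem vertexWeight_pos {m : ℕ} {δ : ℝ} (hδ : -(m : ℝ) < δ) (d q c c' n : ℕ) :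
    0 < vertexWeight m δ d q c c' n :=
  mul_pos (div_pos (urnMoment_pos hδ _ _ _) (urnMoment_pos hδ _ _ _))
    (div_pos (passProb_pos hδ _ _) (passProb_pos hδ _ _))

theorem hasPowerLaw_vertexWeight {m : ℕ} {δ : ℝ} (hm : 1 ≤ m) (hδ : -(m : ℝ) < δ)
    (d q c c' : ℕ) :
    HasPowerLaw (vertexWeight m δ d q c c') ((m + δ) / (2 * m + δ) * ((c' : ℝ) - c) - d) := by
  have h := ((hasPowerLaw_urnMoment hm hδ d q).div (hasPowerLaw_urnMoment hm hδ 0 c)).mul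
    ((hasPowerLaw_passProb hm hδ c).div (hasPowerLaw_passProb hm hδ c'))
  have hexp : -(d : ℝ) - -((0 : ℕ) : ℝ) + (-((m + δ) / (2 * m + δ) * (c : ℝ)) -
      -((m + δ) / (2 * m + δ) * (c' : ℝ))) = (m + δ) / (2 * m + δ) * ((c' : ℝ) - c) - d := by
    push_cast
    ring
  rwa [hexp] at h

/-! ### The probability of a copy -/

section

variable {ι : Type*} [Fintype ι]

/-- The number of edges that end at `i`. -/
def endCount (tgt : ι → ℕ) (i : ℕ) : ℕ := (Finset.univ.filter fun e => tgt e = i).card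

/-- The number of edges that pass over `i`. -/
def overCount (src tgt : ι → ℕ) (i : ℕ) : ℕ :=
  (Finset.univ.filter fun e => tgt e < i ∧ i < src e).card

/-- The number of edges that pass over the gap below `i`. -/
def gapCount (src tgt : ι → ℕ) (i : ℕ) : ℕ :=
  (Finset.univ.filter fun e => tgt e < i ∧ i ≤ src e).card

theorem gapCount_succ {src tgt : ι → ℕ} (h : ∀ e, tgt e < src e) (i : ℕ) :
    gapCount src tgt (i + 1) = endCount tgt i + overCount src tgt i := by
  classical
  unfold gapCount endCount overCount
  rw [← Finset.card_union_of_disjoint]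
  · congr 1
    ext e
    have := h e
    simp only [Finset.mem_union, Finset.mem_filter, Finset.mem_univ, true_and]
    omega
  · rw [Finset.disjoint_left]
    intro e h1 h2
    simp only [Finset.mem_filter] at h1 h2
    omega

theorem gapCount_eq {src tgt : ι → ℕ} (h : ∀ e, tgt e < src e) (i : ℕ) :
    gapCount src tgt i = endCount src i + overCount src tgt i := by
  classical
  unfold gapCount endCount overCount
  rw [← Finset.card_union_of_disjoint]
  · congr 1
    ext e
    have := h e
    simp only [Finset.mem_union, Finset.mem_filter, Finset.mem_univ, true_and]
    omega
  · rw [Finset.disjoint_left]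
    intro e h1 h2
    simp only [Finset.mem_filter] at h1 h2
    omega

theorem prod_div_telescope {g : ℕ → ℝ} (hg : ∀ i, g i ≠ 0) {N k : ℕ} (h : N ≤ k) :
    ∏ i : Fin k, (if N ≤ (i : ℕ) then g i / g (i + 1) else 1) = g N / g k := by
  rw [Fin.prod_univ_eq_prod_range (fun i => if N ≤ i then g i / g (i + 1) else 1)]
  induction k, h using Nat.le_induction with
  | base =>
    rw [div_self (hg N)]
    exact Finset.prod_eq_one fun i hi => if_neg (Nat.not_le.2 (Finset.mem_range.1 hi))
  | succ k hk ih => rw [Finset.prod_range_succ, ih, if_pos hk, div_mul_div_cancel₀ (hg k)]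

theorem exists_rank {k : ℕ} {p : Fin k → ℕ} (hp : StrictMono p) (v : ℕ) :
    ∃ N ≤ k, ∀ i : Fin k, v ≤ p i ↔ N ≤ (i : ℕ) := by
  classical
  by_cases h : ∃ n, ∃ hn : n < k, v ≤ p ⟨n, hn⟩
  · obtain ⟨hn, hv⟩ := Nat.find_spec h
    refine ⟨Nat.find h, hn.le, fun i => ⟨fun hi => Nat.find_min' h ⟨i.2, hi⟩, fun hi => ?_⟩⟩
    exact hv.trans (hp.monotone (Fin.le_def.2 hi))
  · refine ⟨k, le_rfl, fun i => ⟨fun hi => absurd ⟨i, i.2, hi⟩ h, fun hi => ?_⟩⟩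
    exact absurd i.2 (Nat.not_lt.2 hi)

/-- The weight of the `i`-th vertex of a copy with edges `src e → tgt e`. -/
noncomputable def entryWeight (m : ℕ) (δ : ℝ) (src tgt : ι → ℕ) (i : ℕ) : ℕ → ℝ :=
  vertexWeight m δ (endCount tgt i) (overCount src tgt i) (gapCount src tgt i)
    (gapCount src tgt (i + 1))

/-- The probability of a copy is a product of functions of its single vertices: the edges that pass
over the vertices between `p (i - 1)` and `p i` are the same for all these vertices, and the product
over them is a quotient of values of `passProb`. -/
theorem prod_urnMoment_eq {m : ℕ} {δ : ℝ} (hδ : -(m : ℝ) < δ) {k t : ℕ} (src tgt : ι → Fin k)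
    {p : Fin k → ℕ} (hp : StrictMono p) (hpt : ∀ i, p i < t) :
    ∏ v ∈ Finset.range t, urnMoment m δ v (endCount (fun e => p (tgt e)) v)
      (overCount (fun e => p (src e)) (fun e => p (tgt e)) v) =
    ∏ i : Fin k, entryWeight m δ (fun e => (src e : ℕ)) (fun e => (tgt e : ℕ)) i (p i) := by
  set S : ι → ℕ := fun e => (src e : ℕ) with hS
  set T : ι → ℕ := fun e => (tgt e : ℕ) with hT
  have hgap : ∀ v, urnMoment m δ v 0 (gapCount (fun e => p (src e)) (fun e => p (tgt e)) v) =
      ∏ i : Fin k, (if v ≤ p i then urnMoment m δ v 0 (gapCount S T i) /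
        urnMoment m δ v 0 (gapCount S T (i + 1)) else 1) := by
    intro v
    obtain ⟨N, hN, hNp⟩ := exists_rank hp v
    have h1 : gapCount (fun e => p (src e)) (fun e => p (tgt e)) v = gapCount S T N := by
      unfold gapCount
      congr 1
      refine Finset.filter_congr fun e _ => ?_
      rw [hNp, ← not_le, hNp, not_le]
    have h2 : gapCount S T k = 0 := by
      refine Finset.card_eq_zero.2 (Finset.filter_eq_empty_iff.2 fun e _ h => ?_)
      exact absurd (src e).2 (Nat.not_lt.2 h.2)
    simp only [hNp]
    rw [prod_div_telescope (g := fun i => urnMoment m δ v 0 (gapCount S T i))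
      (fun i => (urnMoment_pos hδ _ _ _).ne') hN, h1, h2, urnMoment_zero_zero, div_one]
  have key : ∀ v, urnMoment m δ v (endCount (fun e => p (tgt e)) v)
      (overCount (fun e => p (src e)) (fun e => p (tgt e)) v) =
      ∏ i : Fin k, ((if p i = v then urnMoment m δ v (endCount T i) (overCount S T i) /
        urnMoment m δ v 0 (gapCount S T i) else 1) *
      (if v ≤ p i then urnMoment m δ v 0 (gapCount S T i) /
        urnMoment m δ v 0 (gapCount S T (i + 1)) else 1)) := by
    intro v
    rw [Finset.prod_mul_distrib, ← hgap]
    by_cases hv : ∃ i, p i = v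
    · obtain ⟨i, rfl⟩ := hv
      simp only [hp.injective.eq_iff]
      rw [Finset.prod_ite_eq' Finset.univ i fun j =>
        urnMoment m δ (p i) (endCount T j) (overCount S T j) /
          urnMoment m δ (p i) 0 (gapCount S T j), if_pos (Finset.mem_univ i)]
      have h1 : endCount (fun e => p (tgt e)) (p i) = endCount T i := by
        simp only [endCount, hp.injective.eq_iff, hT, Fin.ext_iff]
      have h2 : overCount (fun e => p (src e)) (fun e => p (tgt e)) (p i) = overCount S T i := by
        simp only [overCount, hp.lt_iff_lt, hT, hS, Fin.lt_def]
      have h3 : gapCount (fun e => p (src e)) (fun e => p (tgt e)) (p i) = gapCount S T i := by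
        simp only [gapCount, hp.lt_iff_lt, hp.le_iff_le, hT, hS, Fin.lt_def, Fin.le_def]
      rw [h1, h2, h3, div_mul_cancel₀ _ (urnMoment_pos hδ _ _ _).ne']
    · push Not at hv
      rw [Finset.prod_eq_one fun i _ => if_neg (hv i), one_mul]
      have h1 : endCount (fun e => p (tgt e)) v = 0 :=
        Finset.card_eq_zero.2 (Finset.filter_eq_empty_iff.2 fun e _ => hv _)
      have h2 : overCount (fun e => p (src e)) (fun e => p (tgt e)) v =
          gapCount (fun e => p (src e)) (fun e => p (tgt e)) v := by
        unfold overCount gapCount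
        congr 1
        refine Finset.filter_congr fun e _ => and_congr_right fun _ => ?_
        exact ⟨le_of_lt, fun h => lt_of_le_of_ne h (hv (src e)).symm⟩
      rw [h1, h2]
  rw [Finset.prod_congr rfl fun v _ => key v, Finset.prod_comm]
  refine Finset.prod_congr rfl fun i _ => ?_
  rw [Finset.prod_mul_distrib, Finset.prod_ite_eq, if_pos (Finset.mem_range.2 (hpt i)),
    ← Finset.prod_filter]
  have : (Finset.range t).filter (fun v => v ≤ p i) = Finset.range (p i + 1) := by
    ext v
    have := hpt i
    simp only [Finset.mem_filter, Finset.mem_range]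
    omega
  rw [this, Finset.prod_div_distrib]
  rfl

variable {m t : ℕ}

/-- The probability that the given labeled edges are present. Distinct edges of the same vertex
need distinct labels. -/
theorem sum_weight_isEdge {δ : ℝ} (hδ : -(m : ℝ) < δ) (a b : ι → Fin t) (hab : ∀ e, b e < a e)
    (ℓ : ι → Fin m) (hinj : ∀ e f, a e = a f → ℓ e = ℓ f → e = f)
    [DecidablePred fun G : Graph m t => ∀ e, IsEdge G (ℓ e) (a e) (b e)] :
    ∑ G ∈ Finset.univ.filter (fun G : Graph m t => ∀ e, IsEdge G (ℓ e) (a e) (b e)), weight δ G =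
      ∏ v ∈ Finset.range t, urnMoment m δ v (endCount (fun e => (b e : ℕ)) v)
        (overCount (fun e => (a e : ℕ)) (fun e => (b e : ℕ)) v) := by
  classical
  have ha : ∀ e, (a e : ℕ) - 1 < t - 1 := fun e => by
    have h1 := Fin.lt_def.1 (hab e)
    have h2 := (a e).2
    omega
  have ha1 : ∀ e, (a e : ℕ) - 1 + 1 = a e := fun e => by
    have h1 := Fin.lt_def.1 (hab e)
    omega
  let slot : ι → Fin (t - 1) × Fin m := fun e => (⟨(a e : ℕ) - 1, ha e⟩, ℓ e)
  have hslot : Function.Injective slot := by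
    intro e f h
    have h1 : (a e : ℕ) - 1 = (a f : ℕ) - 1 := congrArg (fun s => (s.1 : ℕ)) h
    have h2 : ℓ e = ℓ f := congrArg Prod.snd h
    refine hinj e f (Fin.ext ?_) h2
    rw [← ha1 e, ← ha1 f, h1]
  have hex : ∃ G₀ : Graph m t, ∀ e, (G₀ (slot e) : ℕ) = b e := by
    have : ∀ s : Fin (t - 1) × Fin m, ∃ x : Fin (s.1 + 1), ∀ e, slot e = s → (x : ℕ) = b e := by
      intro s
      by_cases h : ∃ e, slot e = s
      · obtain ⟨e, rfl⟩ := h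
        refine ⟨⟨b e, ?_⟩, fun f hf => by rw [hslot hf]⟩
        have h1 := Fin.lt_def.1 (hab e)
        rw [← ha1 e] at h1
        exact h1
      · exact ⟨0, fun e he => absurd ⟨e, he⟩ h⟩
    choose G₀ hG₀ using this
    exact ⟨G₀, fun e => hG₀ _ e rfl⟩
  obtain ⟨G₀, hG₀⟩ := hex
  have hedge : ∀ (G : Graph m t) e, IsEdge G (ℓ e) (a e) (b e) ↔ G (slot e) = G₀ (slot e) := by
    intro G e
    rw [Fin.ext_iff, hG₀]
    constructor
    · rintro ⟨w, hw, h⟩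
      have : w = ⟨(a e : ℕ) - 1, ha e⟩ := Fin.ext (by simp only; omega)
      rwa [this] at h
    · intro h
      exact ⟨⟨(a e : ℕ) - 1, ha e⟩, ha1 e, h⟩
  have hfilter : Finset.univ.filter (fun G : Graph m t => ∀ e, IsEdge G (ℓ e) (a e) (b e)) =
      Finset.univ.filter fun G : Graph m t => ∀ s ∈ Finset.univ.image slot, G s = G₀ s := by
    refine Finset.filter_congr fun G _ => ?_
    simp [hedge]
  rw [hfilter, sum_weight_filter hδ]
  refine Finset.prod_congr rfl fun v _ => ?_
  have h1 : inCount (Finset.univ.image slot) G₀ v = endCount (fun e => (b e : ℕ)) v := by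
    unfold inCount endCount
    rw [Finset.filter_image, Finset.card_image_of_injective _ hslot]
    simp only [hG₀]
  have h2 : jumpCount (Finset.univ.image slot) G₀ v =
      overCount (fun e => (a e : ℕ)) (fun e => (b e : ℕ)) v := by
    unfold jumpCount overCount
    rw [Finset.filter_image, Finset.card_image_of_injective _ hslot]
    congr 1
    refine Finset.filter_congr fun e _ => ?_
    rw [hG₀]
    refine and_congr_right fun _ => ?_
    have := ha1 e
    simp only [slot]
    omega
  rw [h1, h2]

end

/-! ### The number of copies -/

open Classical in
theorem sum_strictMono (w : ℕ → ℕ → ℝ) (k t : ℕ) :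
    ∑ p ∈ (Fintype.piFinset fun _ : Fin k => Finset.range t).filter (fun p => StrictMono p),
      ∏ i : Fin k, w i (p i) = simplexSum w k t := by
  induction k generalizing t with
  | zero =>
    rw [Finset.filter_true_of_mem fun p _ => Subsingleton.strictMono p]
    simp [simplexSum]
  | succ k ih =>
    simp only [simplexSum, ← ih, Finset.mul_sum]
    rw [Finset.sum_sigma']
    refine Finset.sum_bij' (fun p _ => ⟨p (Fin.last k), fun i => p i.castSucc⟩)
      (fun q _ => Fin.snoc (α := fun _ => ℕ) q.2 q.1) ?_ ?_ ?_ ?_ ?_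
    · intro p hp
      simp only [Finset.mem_filter, Fintype.mem_piFinset, Finset.mem_range, Finset.mem_sigma]
        at hp ⊢
      exact ⟨hp.1 _, fun i => hp.2 (Fin.castSucc_lt_last i),
        fun i j hij => hp.2 (Fin.castSucc_lt_castSucc_iff.2 hij)⟩
    · rintro ⟨n, q⟩ hq
      simp only [Finset.mem_filter, Fintype.mem_piFinset, Finset.mem_range, Finset.mem_sigma]
        at hq ⊢
      obtain ⟨hn, hqn, hq⟩ := hq
      refine ⟨fun i => ?_, fun i j hij => ?_⟩
      · induction i using Fin.lastCases with
        | last => simpa using hn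
        | cast i => simpa using (hqn i).trans hn
      · induction j using Fin.lastCases with
        | last =>
          induction i using Fin.lastCases with
          | last => exact absurd hij (lt_irrefl _)
          | cast i => simpa using hqn i
        | cast j =>
          induction i using Fin.lastCases with
          | last => exact absurd (hij.trans (Fin.castSucc_lt_last j)) (lt_irrefl _)
          | cast i => simpa using hq (Fin.castSucc_lt_castSucc_iff.1 hij)
    · intro p hp
      exact Fin.snoc_init_self p
    · rintro ⟨n, q⟩ hq
      simp
    · intro p hp
      rw [Fin.prod_univ_castSucc, mul_comm]
      rfl

theorem expectedCopies_eq_sum {V : Type*} [Fintype V] (m : ℕ) (δ : ℝ) (hδ : -(m : ℝ) < δ)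
    (H : Digraph V) {k : ℕ} (π : V ≃ Fin k) (t : ℕ) :
    expectedCopies m δ hδ H π t = ∑ G : Graph m t, weight δ G * copies H π G := by
  unfold expectedCopies
  rw [PMF.integral_eq_sum]
  refine Finset.sum_congr rfl fun G _ => ?_
  rw [PA, PMF.ofFintype_apply, ENNReal.toReal_ofReal (weight_nonneg hδ G), smul_eq_mul]

section

variable {V : Type*} [Fintype V]

open Classical in
/-- The ways to label the edges of `H` such that edges that start from the same vertex have distinct
labels. -/
noncomputable def labelings (m : ℕ) (H : Digraph V) :
    Finset ({e : V × V // H.Adj e.1 e.2} → Fin m) :=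
  Finset.univ.filter fun ℓ => ∀ e f, e.1.1 = f.1.1 → ℓ e = ℓ f → e = f

theorem labelings_card_pos {m : ℕ} {H : Digraph V} (h : ∀ a, outDeg H a ≤ m) :
    0 < (labelings m H).card := by
  classical
  have h1 : ∀ a, Nonempty ({u // H.Adj a u} ↪ Fin m) := by
    intro a
    refine Function.Embedding.nonempty_of_card_le ?_
    rw [Fintype.card_fin, Fintype.card_subtype]
    convert h a
    unfold outDeg
    congr
  refine Finset.card_pos.2 ⟨fun e => (h1 e.1.1).some ⟨e.1.2, e.2⟩, ?_⟩
  simp only [labelings, Finset.mem_filter, Finset.mem_univ, true_and]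
  rintro ⟨⟨a, u⟩, hu⟩ ⟨⟨a', u'⟩, hu'⟩ haa' hl
  obtain rfl : a = a' := haa'
  have := (h1 a).some.injective hl
  simpa using this

open Classical in
theorem expectedCopies_eq {m : ℕ} {δ : ℝ} (hδ : -(m : ℝ) < δ) {H : Digraph V} {k : ℕ}
    {π : V ≃ Fin k} (hH : ∀ a b, H.Adj a b → π b < π a) (t : ℕ) :
    expectedCopies m δ hδ H π t = (labelings m H).card *
      simplexSum (entryWeight m δ (fun e : {e : V × V // H.Adj e.1 e.2} => (π e.1.1 : ℕ))
        (fun e : {e : V × V // H.Adj e.1 e.2} => (π e.1.2 : ℕ))) k t := by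
  have h1 : ∀ (φ : V → Fin t), (∀ a b, φ a < φ b ↔ π a < π b) →
      ∀ ℓ : {e : V × V // H.Adj e.1 e.2} → Fin m,
      (∑ G : Graph m t, if ∀ e, IsEdge G (ℓ e) (φ e.1.1) (φ e.1.2) then weight δ G else 0) =
      if ℓ ∈ labelings m H then
        ∏ i : Fin k, entryWeight m δ (fun e : {e : V × V // H.Adj e.1 e.2} => (π e.1.1 : ℕ))
        (fun e : {e : V × V // H.Adj e.1 e.2} => (π e.1.2 : ℕ)) i (φ (π.symm i)) else 0 := by
    intro φ hφ ℓ
    have hinj : Function.Injective φ := by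
      intro a b hab
      refine π.injective (le_antisymm (not_lt.1 fun h => ?_) (not_lt.1 fun h => ?_))
      · exact absurd ((hφ b a).2 h) (by simp [hab])
      · exact absurd ((hφ a b).2 h) (by simp [hab])
    by_cases hℓ : ℓ ∈ labelings m H
    · rw [if_pos hℓ, ← Finset.sum_filter, sum_weight_isEdge hδ (fun e => φ e.1.1) (fun e => φ e.1.2)
        (fun e => (hφ _ _).2 (hH _ _ e.2)) ℓ]
      · have hp : StrictMono fun i : Fin k => (φ (π.symm i) : ℕ) := fun i j hij =>
          Fin.lt_def.1 ((hφ _ _).2 (by simpa using hij))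
        have := prod_urnMoment_eq hδ (t := t)
          (fun e : {e : V × V // H.Adj e.1 e.2} => π e.1.1)
          (fun e : {e : V × V // H.Adj e.1 e.2} => π e.1.2) hp fun i => (φ (π.symm i)).2
        simpa only [Equiv.symm_apply_apply] using this
      · intro e f hef
        exact (Finset.mem_filter.1 hℓ).2 e f (hinj hef)
    · rw [if_neg hℓ]
      refine Finset.sum_eq_zero fun G _ => if_neg fun hG => hℓ ?_
      -- two edges of `H` cannot be represented by the same edge of `G`
      refine Finset.mem_filter.2 ⟨Finset.mem_univ _, fun e f hef hl => ?_⟩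
      obtain ⟨w, hw, hwe⟩ := hG e
      obtain ⟨w', hw', hwf⟩ := hG f
      rw [← hef] at hw'
      obtain rfl : w = w' := Fin.ext (by omega)
      rw [hl] at hwe
      exact Subtype.ext (Prod.ext hef (hinj (Fin.ext (hwe.symm.trans hwf))))
  have h2 : ∀ G : Graph m t, weight δ G * copies H π G =
      ∑ φ ∈ Finset.univ.filter (fun φ : V → Fin t => ∀ a b, φ a < φ b ↔ π a < π b),
      ∑ ℓ : {e : V × V // H.Adj e.1 e.2} → Fin m,
        if ∀ e, IsEdge G (ℓ e) (φ e.1.1) (φ e.1.2) then weight δ G else 0 := by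
    intro G
    rw [Finset.sum_filter, copies, Finset.card_filter, ← Finset.univ_product_univ,
      Finset.sum_product, Nat.cast_sum, Finset.mul_sum]
    refine Finset.sum_congr rfl fun φ _ => ?_
    rw [Nat.cast_sum, Finset.mul_sum]
    by_cases hφ : ∀ a b, φ a < φ b ↔ π a < π b
    · rw [if_pos hφ]
      refine Finset.sum_congr rfl fun ℓ _ => ?_
      by_cases hG : ∀ e, IsEdge G (ℓ e) (φ e.1.1) (φ e.1.2)
      · rw [if_pos ⟨hφ, hG⟩, if_pos hG, Nat.cast_one, mul_one]
      · rw [if_neg fun h => hG h.2, if_neg hG, Nat.cast_zero, mul_zero]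
    · rw [if_neg hφ]
      refine Finset.sum_eq_zero fun ℓ _ => ?_
      rw [if_neg fun h => hφ h.1, Nat.cast_zero, mul_zero]
  rw [expectedCopies_eq_sum, Finset.sum_congr rfl fun G _ => h2 G, Finset.sum_comm,
    ← sum_strictMono, Finset.mul_sum]
  refine Finset.sum_bij' (fun φ _ i => (φ (π.symm i) : ℕ))
    (fun p hp a => ⟨p (π a), Finset.mem_range.1
      (Fintype.mem_piFinset.1 (Finset.mem_filter.1 hp).1 (π a))⟩) ?_ ?_ ?_ ?_ ?_
  · intro φ hφ
    refine Finset.mem_filter.2 ⟨Fintype.mem_piFinset.2 fun i => Finset.mem_range.2 (Fin.is_lt _),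
      fun i j hij => Fin.lt_def.1 (((Finset.mem_filter.1 hφ).2 _ _).2 (by simpa using hij))⟩
  · intro p hp
    refine Finset.mem_filter.2 ⟨Finset.mem_univ _, fun a b => ?_⟩
    rw [Fin.lt_def]
    exact (Finset.mem_filter.1 hp).2.lt_iff_lt
  · intro φ hφ
    simp
  · intro p hp
    simp
  · intro φ hφ
    rw [Finset.sum_comm, Finset.sum_congr rfl fun ℓ _ => h1 φ (Finset.mem_filter.1 hφ).2 ℓ,
      Finset.sum_ite_mem, Finset.univ_inter, Finset.sum_const, nsmul_eq_mul]

/-! ### The exponents -/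

open Classical in
theorem endCount_src (H : Digraph V) {k : ℕ} (π : V ≃ Fin k) (v : V) :
    endCount (fun e : {e : V × V // H.Adj e.1 e.2} => (π e.1.1 : ℕ)) (π v) = outDeg H v := by
  unfold endCount outDeg
  refine Finset.card_bij' (fun e _ => e.1.2)
    (fun u hu => ⟨(v, u), (Finset.mem_filter.1 hu).2⟩) ?_ ?_ ?_ ?_
  · rintro ⟨⟨a, u⟩, hu⟩ h
    have : (π a : ℕ) = π v := (Finset.mem_filter.1 h).2
    obtain rfl : a = v := π.injective (Fin.ext this)
    exact Finset.mem_filter.2 ⟨Finset.mem_univ _, hu⟩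
  · intro u hu
    simp
  · rintro ⟨⟨a, u⟩, hu⟩ h
    have : (π a : ℕ) = π v := (Finset.mem_filter.1 h).2
    obtain rfl : a = v := π.injective (Fin.ext this)
    rfl
  · intro u hu
    rfl

open Classical in
theorem endCount_tgt (H : Digraph V) {k : ℕ} (π : V ≃ Fin k) (v : V) :
    endCount (fun e : {e : V × V // H.Adj e.1 e.2} => (π e.1.2 : ℕ)) (π v) = inDeg H v := by
  unfold endCount inDeg
  refine Finset.card_bij' (fun e _ => e.1.1)
    (fun u hu => ⟨(u, v), (Finset.mem_filter.1 hu).2⟩) ?_ ?_ ?_ ?_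
  · rintro ⟨⟨u, a⟩, hu⟩ h
    have : (π a : ℕ) = π v := (Finset.mem_filter.1 h).2
    obtain rfl : a = v := π.injective (Fin.ext this)
    exact Finset.mem_filter.2 ⟨Finset.mem_univ _, hu⟩
  · intro u hu
    simp
  · rintro ⟨⟨u, a⟩, hu⟩ h
    have : (π a : ℕ) = π v := (Finset.mem_filter.1 h).2
    obtain rfl : a = v := π.injective (Fin.ext this)
    rfl
  · intro u hu
    rfl

open Classical in
theorem beta_eq {m : ℕ} (hm : 1 ≤ m) {δ : ℝ} (hδ : -(m : ℝ) < δ) {H : Digraph V} {k : ℕ}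
    {π : V ≃ Fin k} (hH : ∀ a b, H.Adj a b → π b < π a) (v : V) :
    beta m δ H v = (m + δ) / (2 * m + δ) *
      ((gapCount (fun e : {e : V × V // H.Adj e.1 e.2} => (π e.1.1 : ℕ)) (fun e => (π e.1.2 : ℕ))
        (π v + 1) : ℝ) -
      gapCount (fun e : {e : V × V // H.Adj e.1 e.2} => (π e.1.1 : ℕ)) (fun e => (π e.1.2 : ℕ))
        (π v)) -
      endCount (fun e : {e : V × V // H.Adj e.1 e.2} => (π e.1.2 : ℕ)) (π v) := by
  have hlt : ∀ e : {e : V × V // H.Adj e.1 e.2}, (π e.1.2 : ℕ) < (π e.1.1 : ℕ) :=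
    fun e => Fin.lt_def.1 (hH _ _ e.2)
  have hm' : (0 : ℝ) < m := by exact_mod_cast hm
  have h2 := two_mul_add_pos hm hδ
  have h3 : (tau m δ - 2) / (tau m δ - 1) = (m + δ) / (2 * m + δ) := by
    have h4 : tau m δ - 2 = (m + δ) / m := by
      unfold tau
      field_simp
      ring
    have h5 : tau m δ - 1 = (2 * m + δ) / m := by
      unfold tau
      field_simp
      ring
    rw [h4, h5, div_div_div_cancel_right₀ hm'.ne']
  rw [gapCount_succ hlt, gapCount_eq hlt, endCount_src, endCount_tgt, beta, h3]
  push_cast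
  ring

theorem add_objective_eq {m : ℕ} {δ : ℝ} {H : Digraph V} {k : ℕ} {π : V ≃ Fin k} {b : ℕ → ℝ}
    (hb : ∀ i : Fin k, b i = beta m δ H (π.symm i)) {s : ℕ} (hs : s ≤ k) :
    (k : ℝ) + objective m δ H π s = splitExponent b k s := by
  have h1 : ∑ i ∈ Finset.univ.filter (fun i : Fin k => s ≤ (i : ℕ)), beta m δ H (π.symm i) =
      ∑ i ∈ Finset.Ico s k, b i := by
    simp only [← hb]
    rw [Finset.sum_filter, Fin.sum_univ_eq_sum_range fun i => if s ≤ i then b i else 0,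
      ← Finset.sum_filter]
    congr 1
    ext i
    simp only [Finset.mem_filter, Finset.mem_range, Finset.mem_Ico]
    omega
  rw [objective, h1, splitExponent, Finset.sum_add_distrib, Finset.sum_const, Nat.card_Ico,
    nsmul_eq_mul, Nat.cast_sub hs]
  ring

end

end PrefAttach

theorem theorem1 {V : Type*} [Fintype V] (m : ℕ) (hm : 1 ≤ m) (δ : ℝ) (hδ : -(m : ℝ) < δ)
    (H : Digraph V) (k : ℕ) (π : V ≃ Fin k) (hH : PrefAttach.Attainable m H π)
    (r : ℕ) (hr : PrefAttach.numOptimizers m δ H π = r) :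
    ∃ C₁ C₂ L : ℝ, 0 < C₁ ∧ C₁ ≤ L ∧ L ≤ C₂ ∧
      Tendsto (fun t : ℕ => PrefAttach.expectedCopies m δ hδ H π t /
          ((t : ℝ) ^ ((k : ℝ) + PrefAttach.optValue m δ H π) * Real.log t ^ (r - 1)))
        atTop (𝓝 L) := by
  classical
  open PrefAttach in
  let src : {e : V × V // H.Adj e.1 e.2} → ℕ := fun e => π e.1.1
  let tgt : {e : V × V // H.Adj e.1 e.2} → ℕ := fun e => π e.1.2
  let b : ℕ → ℝ := fun i => (m + δ) / (2 * m + δ) *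
    ((gapCount src tgt (i + 1) : ℝ) - gapCount src tgt i) - endCount tgt i
  have hb : ∀ i : Fin k, b i = beta m δ H (π.symm i) := by
    intro i
    rw [beta_eq hm hδ hH.1, Equiv.apply_symm_apply]
  have hobj : ∀ s, s ≤ k → (k : ℝ) + objective m δ H π s = splitExponent b k s :=
    fun s hs => add_objective_eq hb hs
  have hle : ∀ s, s ≤ k → splitExponent b k s ≤ (k : ℝ) + optValue m δ H π := by
    intro s hs
    rw [← hobj s hs]
    exact add_le_add_right
      (Finset.le_sup' (objective m δ H π) (Finset.mem_range.2 (Nat.lt_succ_iff.2 hs))) _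
  have hex : ∃ s, s ≤ k ∧ splitExponent b k s = (k : ℝ) + optValue m δ H π := by
    obtain ⟨s, hs, h⟩ := Finset.exists_mem_eq_sup' Finset.nonempty_range_add_one
      (objective m δ H π) (s := Finset.range (k + 1))
    have hs' : s ≤ k := Nat.lt_succ_iff.1 (Finset.mem_range.1 hs)
    exact ⟨s, hs', by rw [← hobj s hs', optValue, h]⟩
  have hcard : ((Finset.range (k + 1)).filter fun s =>
      splitExponent b k s = (k : ℝ) + optValue m δ H π).card = r := by
    rw [← hr, numOptimizers]
    congr 1
    refine Finset.filter_congr fun s hs => ?_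
    rw [← hobj s (Nat.lt_succ_iff.1 (Finset.mem_range.1 hs)), add_right_inj]
  obtain ⟨C, hC, hlim⟩ := tendsto_simplexSum (w := entryWeight m δ src tgt) (b := b)
    (fun i n => (vertexWeight_pos hδ _ _ _ _ _).le)
    (fun i => hasPowerLaw_vertexWeight hm hδ _ _ _ _) k hle hex
  rw [hcard] at hlim
  have hM : (0 : ℝ) < (labelings m H).card := by exact_mod_cast labelings_card_pos hH.2
  refine ⟨(labelings m H).card * C, (labelings m H).card * C, (labelings m H).card * C,
    mul_pos hM hC, le_rfl, le_rfl, (hlim.const_mul _).congr fun t => ?_⟩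
  rw [expectedCopies_eq hδ hH.1, mul_div_assoc]
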